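/- **Theorem.** Let $D$ be a degree sequence of a tree, i.e. a finite multiset of non-negative integers $d_0\ge d_1\ge\dots\ge d_{n-1}$ that is the multiset of vertex degrees of some tree. The *greedy tree* $\mathcal{G}(D)$ is the tree on the vertices $v_0,\dots,v_{n-1}$ built as follows: start with the root $v_0$; process the vertices in the order $v_0,v_1,v_2,\dots$, where processing $v_0$ means joining it to the next $d_0$ vertices $v_1,\dots,v_{d_0}$, and processing $v_i$ for $i\ge 1$ means joining it to the next $d_i-1$ vertices that have not yet been attached. For a finite connected graph $G$ and $r\ge 1$, the *Steiner distance* of a set $S$ of $r$ vertices is the least number of edges of a subtree of $G$ that contains all vertices of $S$, the *Steiner $r$-Wiener index* $\mathrm{SW}_r(G)$ is the sum of the Steiner distances of all $r$-element sets of vertices of $G$, and the *Wiener index* $W(G)$ is the sum of the distances $d(u,v)$ over all unordered pairs of vertices. Then $\mathcal{G}(D)$ is a tree with degree sequence $D$, and for every integer $r\ge 1$ and every tree $T$ with degree sequence $D$: 1. $\mathrm{SW}_r(\mathcal{G}(D))\le \mathrm{SW}_r(T)$, i.e. the greedy tree minimises the Steiner $r$-Wiener index among all trees with degree sequence $D$;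 2. for every real $\varepsilon>0$, $$\mathrm{SW}_r(\mathcal{G}(D))+\varepsilon W(\mathcal{G}(D))\le \mathrm{SW}_r(T)+\varepsilon W(T),$$ with equality if and only if $T$ is isomorphic to $\mathcal{G}(D)$. -/

import Mathlib

namespace SteinerWiener

/-- `D` is the multiset of vertex degrees of the finite graph `G`. -/
def HasDegreeSequence {V : Type*} [Fintype V] (G : SimpleGraph V) (D : Multiset ℕ) : Prop :=
  open Classical in Finset.univ.val.map (fun v => G.degree v) = D

/-- `D` is the degree sequence of some tree. -/
def IsTreeDegreeSequence (D : Multiset ℕ) : Prop :=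
  ∃ T : SimpleGraph (Fin D.card), T.IsTree ∧ HasDegreeSequence T D

/-- The `i`-th largest entry of `D`, counting from `0` (and `0` beyond the end of `D`). -/
def sortedDegree (D : Multiset ℕ) (i : ℕ) : ℕ :=
  (D.sort (· ≥ ·)).getD i 0

/-- In the greedy algorithm vertices are labelled `0, 1, 2, …` in the order in which they appear,
and the `i`-th labelled vertex receives the `i`-th largest degree. The vertices are processed in
the order of their labels. `labelledCount D i` is the number of vertices that carry a label just
before vertex `i` is processed: at first only the root `0` is labelled; processing the root labels
all its `d 0` neighbours; processing a vertex `i ≠ 0` labels its `d i - 1` neighbours other than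
the one from which it was reached. -/
def labelledCount (D : Multiset ℕ) : ℕ → ℕ
  | 0 => 1
  | i + 1 => labelledCount D i + (if i = 0 then sortedDegree D 0 else sortedDegree D i - 1)

/-- The greedy tree `G(D)`: vertex `j` is a child of vertex `i` if `j` gets its label when `i` is
processed. -/
def greedyTree (D : Multiset ℕ) : SimpleGraph (Fin D.card) :=
  SimpleGraph.fromRel fun i j =>
    labelledCount D i ≤ (j : ℕ) ∧ (j : ℕ) < labelledCount D (i + 1)

/-- The Steiner distance of a set `S` of vertices: the least number of edges of a subtree of `G`
that contains all vertices of `S`. -/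
noncomputable def steinerDist {V : Type*} (G : SimpleGraph V) (S : Set V) : ℕ :=
  sInf {k | ∃ H : G.Subgraph, H.coe.IsTree ∧ S ⊆ H.verts ∧ H.edgeSet.ncard = k}

/-- The Steiner `r`-Wiener index: the sum of the Steiner distances of all sets of `r` vertices. -/
noncomputable def steinerWiener {V : Type*} [Fintype V] (r : ℕ) (G : SimpleGraph V) : ℕ :=
  ∑ S ∈ (Finset.univ : Finset V).powersetCard r, steinerDist G (S : Set V)

/-- The Wiener index: the sum of the distances between all unordered pairs of vertices
(the pairs `{v, v}` contribute `0`). -/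
noncomputable def wiener {V : Type*} [Fintype V] (G : SimpleGraph V) : ℕ :=
  open Classical in ∑ p : Sym2 V, Sym2.lift ⟨fun u v => G.dist u v, fun _ _ => G.dist_comm⟩ p

end SteinerWiener

/-! ### Rooted trees as parent functions: ancestors, depths and descendant counts. -/

namespace SteinerWiener

open scoped Classical

/-! Root a tree on n vertices at c. The edge from v ≠ c to its parent cuts off x = `size par v`
vertices, and it contributes once for every r-set and every pair that it separates. Hence SW_r + εW
is the sum over the edges of φ(x) = C(n,r) − C(x,r) − C(n−x,r) + ε x(n−x) (`edgeSum_edgeWeight`).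
This φ is symmetric under x ↦ n−x and strictly concave, the strictness coming from ε > 0
(`strictConcaveSymm_edgeWeight`).

Take a minimiser, rooted at a centroid (`exists_balanced`). Suppose that a dominates b: level by
level, the ancestors of a have at least as many descendants as those of b. Moving weight from below
b to below a spreads the paired sizes on the two paths to the root and so, by concavity, lowers the
sum (`Exchangeable.edgeSum_lt`). In a minimiser, therefore, the children of b are no larger than
those of a, and deg b ≤ deg a. It follows that dominance is a total preorder, and with suitable
tie-breaking it becomes a breadth-first order with non-increasing degrees (`exists_order`). Such an
order forces the greedy tree (`nonempty_iso_greedyTree`).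

Minimisers exist by finiteness and are all isomorphic to the greedy tree; this settles ε > 0 with
its equality case. Since SW_r is an integer, a small enough ε yields the bound for SW_r alone. -/

/-- `par` is the parent function of a rooted tree with root `c`, where `c` is its own parent. -/
structure IsRooted {V : Type*} (par : V → V) (c : V) : Prop where
  root : par c = c
  reach : ∀ v, ∃ k, par^[k] v = c

/-- `v` is an ancestor of `x` (possibly `x` itself). -/
def Anc {V : Type*} (par : V → V) (v x : V) : Prop := ∃ k, par^[k] x = v

/-- The children of `v` in the tree with root `c`. -/
noncomputable def children {V : Type*} [Fintype V] (par : V → V) (c v : V) : Finset V :=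
  {x | x ≠ c ∧ par x = v}

/-- The number of descendants of `v`, including `v`. -/
noncomputable def size {V : Type*} [Fintype V] (par : V → V) (v : V) : ℕ :=
  Finset.card {x | Anc par v x}

/-- The distance from `v` to the root. -/
noncomputable def IsRooted.depth {V : Type*} {par : V → V} {c : V} (h : IsRooted par c) (v : V) :
    ℕ := Nat.find (h.reach v)

theorem Anc.refl {V : Type*} (par : V → V) (v : V) : Anc par v v := ⟨0, rfl⟩

theorem Anc.iterate {V : Type*} (par : V → V) (k : ℕ) (v : V) : Anc par (par^[k] v) v := ⟨k, rfl⟩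

theorem Anc.par {V : Type*} (par : V → V) (v : V) : Anc par (par v) v := ⟨1, rfl⟩

theorem Anc.trans {V : Type*} {par : V → V} {u v w : V} (h₁ : Anc par u v) (h₂ : Anc par v w) :
    Anc par u w := by
  obtain ⟨i, rfl⟩ := h₁
  obtain ⟨j, rfl⟩ := h₂
  exact ⟨i + j, Function.iterate_add_apply _ _ _ _⟩

theorem Anc.comparable {V : Type*} {par : V → V} {u v x : V} (hu : Anc par u x)
    (hv : Anc par v x) : Anc par u v ∨ Anc par v u := by
  obtain ⟨i, rfl⟩ := hu
  obtain ⟨j, rfl⟩ := hv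
  rcases le_total i j with hij | hij
  · refine Or.inr ⟨j - i, ?_⟩
    rw [← Function.iterate_add_apply, Nat.sub_add_cancel hij]
  · refine Or.inl ⟨i - j, ?_⟩
    rw [← Function.iterate_add_apply, Nat.sub_add_cancel hij]

namespace IsRooted

variable {V : Type*} {par : V → V} {c : V} (h : IsRooted par c)

include h

theorem iterate_root (k : ℕ) : par^[k] c = c := Function.iterate_fixed h.root k

theorem iterate_depth (v : V) : par^[h.depth v] v = c := Nat.find_spec (h.reach v)

theorem iterate_of_depth_le {v : V} {k : ℕ} (hk : h.depth v ≤ k) : par^[k] v = c := by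
  obtain ⟨j, rfl⟩ := Nat.exists_eq_add_of_le' hk
  rw [Function.iterate_add_apply, h.iterate_depth, h.iterate_root]

theorem depth_le {v : V} {k : ℕ} (hk : par^[k] v = c) : h.depth v ≤ k := Nat.find_min' _ hk

theorem depth_root : h.depth c = 0 := Nat.le_zero.1 (h.depth_le rfl)

theorem depth_eq_zero {v : V} : h.depth v = 0 ↔ v = c := by
  refine ⟨fun hv => ?_, fun hv => hv ▸ h.depth_root⟩
  have := h.iterate_depth v
  rwa [hv] at this

theorem depth_par {v : V} (hv : v ≠ c) : h.depth (par v) + 1 = h.depth v := by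
  have h0 : h.depth v ≠ 0 := fun h' => hv (h.depth_eq_zero.1 h')
  obtain ⟨m, hm⟩ := Nat.exists_eq_succ_of_ne_zero h0
  apply le_antisymm
  · have := h.iterate_depth v
    rw [hm, Function.iterate_succ_apply] at this
    have := h.depth_le this
    omega
  · apply h.depth_le
    rw [Function.iterate_succ_apply]
    exact h.iterate_depth _

theorem depth_iterate (v : V) (k : ℕ) : h.depth (par^[k] v) = h.depth v - k := by
  induction k generalizing v with
  | zero => rfl
  | succ k ih =>
    rw [Function.iterate_succ_apply, ih]
    by_cases hv : v = c
    · subst hv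
      rw [h.root, h.depth_root]
      omega
    · have := h.depth_par hv
      omega

theorem depth_le_of_anc {v x : V} (ha : Anc par v x) : h.depth v ≤ h.depth x := by
  obtain ⟨k, rfl⟩ := ha
  rw [h.depth_iterate]
  omega

theorem anc_root (x : V) : Anc par c x := h.reach x

theorem iterate_of_anc {v x : V} (ha : Anc par v x) : par^[h.depth x - h.depth v] x = v := by
  obtain ⟨k, rfl⟩ := ha
  rw [h.depth_iterate]
  rcases le_total k (h.depth x) with hk | hk
  · congr 1; omega
  · rw [h.iterate_of_depth_le hk, h.iterate_of_depth_le (by omega)]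

theorem anc_antisymm {v x : V} (h₁ : Anc par v x) (h₂ : Anc par x v) : v = x := by
  have := h.iterate_of_anc h₁
  rw [← this, show h.depth x - h.depth v = 0 by have := h.depth_le_of_anc h₂; omega]
  rfl

theorem eq_of_anc_of_depth_eq {u v x : V} (hu : Anc par u x) (hv : Anc par v x)
    (hd : h.depth u = h.depth v) : u = v := by
  rw [← h.iterate_of_anc hu, ← h.iterate_of_anc hv, hd]

theorem not_anc_par {v : V} (hv : v ≠ c) : ¬ Anc par v (par v) := fun ha => by
  have := h.depth_le_of_anc ha
  have := h.depth_par hv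
  omega

theorem par_ne {v : V} (hv : v ≠ c) : par v ≠ v := fun ha =>
  h.not_anc_par hv (by rw [ha]; exact Anc.refl _ _)

omit h in
theorem anc_par_of_ne {v x : V} (ha : Anc par v x) (hne : v ≠ x) : Anc par v (par x) := by
  obtain ⟨k, rfl⟩ := ha
  cases k with
  | zero => exact absurd rfl hne
  | succ k => exact ⟨k, (Function.iterate_succ_apply _ _ _).symm⟩

/-- Every proper descendant of `v` lies below a child of `v`. -/
theorem exists_child_anc {v x : V} (ha : Anc par v x) (hne : v ≠ x) :
    ∃ y, y ≠ c ∧ par y = v ∧ Anc par y x := by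
  have h1 := h.iterate_of_anc ha
  have h2 : h.depth x - h.depth v ≠ 0 := fun h0 => by
    rw [h0] at h1
    exact hne h1.symm
  obtain ⟨m, hm⟩ := Nat.exists_eq_succ_of_ne_zero h2
  refine ⟨par^[m] x, fun hc => ?_, ?_, Anc.iterate _ _ _⟩
  · have := h.depth_le hc
    omega
  · rw [← Function.iterate_succ_apply' par, ← hm, h1]

variable [Fintype V]

omit h in
theorem mem_children {v x : V} : x ∈ children par c v ↔ x ≠ c ∧ par x = v := by
  simp [children]

theorem children_anc_unique {v x y z : V} (hx : x ∈ children par c v) (hy : y ∈ children par c v)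
    (hxz : Anc par x z) (hyz : Anc par y z) : x = y := by
  rw [mem_children] at hx hy
  refine h.eq_of_anc_of_depth_eq hxz hyz ?_
  rw [← h.depth_par hx.1, ← h.depth_par hy.1, hx.2, hy.2]

/-- This makes the indicator of "ancestor of `a`" additive over children up to a correction at `a`
itself, which is what the recursion for sizes after an exchange needs. -/
theorem card_children_anc (v a : V) :
    ((children par c v).filter (fun x => Anc par x a)).card
      = if Anc par v a ∧ v ≠ a then 1 else 0 := by
  split_ifs with hva
  · obtain ⟨y, hyc, hyv, hya⟩ := h.exists_child_anc hva.1 hva.2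
    rw [Finset.card_eq_one]
    refine ⟨y, ?_⟩
    ext x
    rw [Finset.mem_filter, Finset.mem_singleton]
    constructor
    · rintro ⟨hx, hxa⟩
      exact h.children_anc_unique hx (mem_children.2 ⟨hyc, hyv⟩) hxa hya
    · rintro rfl
      exact ⟨mem_children.2 ⟨hyc, hyv⟩, hya⟩
  · rw [Finset.card_eq_zero, Finset.filter_eq_empty_iff]
    intro x hx hxa
    rw [mem_children] at hx
    apply hva
    rw [← hx.2]
    refine ⟨(Anc.par _ _).trans hxa, fun he => h.not_anc_par hx.1 ?_⟩
    rwa [he]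

theorem size_eq (v : V) : size par v = 1 + ∑ x ∈ children par c v, size par x := by
  have h1 : (Finset.univ.filter (fun x => Anc par v x))
      = insert v ((children par c v).biUnion fun y => Finset.univ.filter (fun x => Anc par y x)) := by
    ext x
    simp only [Finset.mem_filter, Finset.mem_univ, true_and, Finset.mem_insert,
      Finset.mem_biUnion, mem_children]
    constructor
    · intro hx
      by_cases hne : v = x
      · exact Or.inl hne.symm
      · obtain ⟨y, h1, h2, h3⟩ := h.exists_child_anc hx hne
        exact Or.inr ⟨y, ⟨h1, h2⟩, h3⟩
    · rintro (rfl | ⟨y, ⟨_, h2⟩, h3⟩)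
      · exact Anc.refl _ _
      · rw [← h2]
        exact (Anc.par _ _).trans h3
  rw [size, h1, Finset.card_insert_of_notMem, Finset.card_biUnion, add_comm]
  · rfl
  · intro x hx y hy hxy
    rw [Function.onFun, Finset.disjoint_left]
    intro z hz hz'
    simp only [Finset.mem_filter, Finset.mem_univ, true_and] at hz hz'
    exact hxy (h.children_anc_unique hx hy hz hz')
  · simp only [Finset.mem_filter, Finset.mem_univ, true_and, Finset.mem_biUnion, mem_children,
      not_exists, not_and, and_imp]
    rintro y hy rfl
    exact h.not_anc_par hy

omit h in
theorem size_pos (v : V) : 0 < size par v :=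
  Finset.card_pos.2 ⟨v, by simpa using Anc.refl par v⟩

omit h in
theorem size_le_card (v : V) : size par v ≤ Fintype.card V := Finset.card_le_univ _

theorem size_root : size par c = Fintype.card V := by
  rw [size, Finset.filter_true_of_mem (fun x _ => h.anc_root x), Finset.card_univ]

omit h in
theorem size_le_of_anc {v x : V} (ha : Anc par v x) : size par x ≤ size par v := by
  apply Finset.card_le_card
  intro y hy
  simp only [Finset.mem_filter, Finset.mem_univ, true_and] at hy ⊢
  exact ha.trans hy

theorem size_lt_of_anc {v x : V} (ha : Anc par v x) (hne : v ≠ x) : size par x < size par v := by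
  apply Finset.card_lt_card
  rw [Finset.ssubset_iff_of_subset]
  · exact ⟨v, by simpa using Anc.refl par v, by
      simpa using fun h' => hne (h.anc_antisymm ha h')⟩
  · intro y hy
    simp only [Finset.mem_filter, Finset.mem_univ, true_and] at hy ⊢
    exact ha.trans hy

theorem size_lt_size_par {v : V} (hv : v ≠ c) : size par v < size par (par v) :=
  h.size_lt_of_anc (Anc.par _ _) (h.par_ne hv)

/-- The sizes are determined by their recursion. -/
theorem eq_size_of_recursion {f : V → ℤ} (hf : ∀ v, f v = 1 + ∑ x ∈ children par c v, f x)
    (v : V) : f v = size par v := by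
  induction hs : size par v using Nat.strong_induction_on generalizing v with
  | _ m ih =>
    subst hs
    rw [hf, h.size_eq, Nat.cast_add, Nat.cast_one, Nat.cast_sum]
    congr 1
    refine Finset.sum_congr rfl fun x hx => ih _ ?_ x rfl
    rw [mem_children] at hx
    rw [← hx.2]
    exact h.size_lt_size_par hx.1

end IsRooted
-- Exchanging branches between two vertices.
/-- Move the children `X` of `b` to `a` and the children `Y` of `a` to `b`. -/
noncomputable def exchange {V : Type*} (par : V → V) (a b : V) (X Y : Finset V) : V → V :=
  fun x => if x ∈ X then a else if x ∈ Y then b else par x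

/-- `X` and `Y` are sets of children of `b` and `a` that can be exchanged. -/
structure Exchangeable {V : Type*} [Fintype V] (par : V → V) (c a b : V) (X Y : Finset V) :
    Prop where
  ne : a ≠ b
  left : X ⊆ children par c b
  right : Y ⊆ children par c a
  not_anc_left : ∀ x ∈ X, ¬ Anc par x a
  not_anc_right : ∀ y ∈ Y, ¬ Anc par y b

namespace Exchangeable

open IsRooted

variable {V : Type*} [Fintype V] {par : V → V} {c a b : V} {X Y : Finset V}
  (h : IsRooted par c) (hE : Exchangeable par c a b X Y)

include h hE

/-- No moved vertex lies on the path from `a` to the root, so the exchange leaves that path intact.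
-/
theorem notMem_of_anc_left {x : V} (hx : Anc par x a) : x ∉ X ∧ x ∉ Y := by
  refine ⟨fun h' => hE.not_anc_left x h' hx, fun h' => ?_⟩
  have := mem_children.1 (hE.right h')
  exact h.not_anc_par this.1 (by rwa [this.2])

theorem notMem_of_anc_right {x : V} (hx : Anc par x b) : x ∉ X ∧ x ∉ Y := by
  refine ⟨fun h' => ?_, fun h' => hE.not_anc_right x h' hx⟩
  have := mem_children.1 (hE.left h')
  exact h.not_anc_par this.1 (by rwa [this.2])

omit h in
theorem root_notMem : c ∉ X ∧ c ∉ Y :=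
  ⟨fun h' => (mem_children.1 (hE.left h')).1 rfl, fun h' => (mem_children.1 (hE.right h')).1 rfl⟩

omit [Fintype V] h hE in
theorem reach_of_forall_notMem {x : V} (k : ℕ) (hk : par^[k] x = c)
    (hx : ∀ y, Anc par y x → y ∉ X ∧ y ∉ Y) : ∃ k, (exchange par a b X Y)^[k] x = c := by
  induction k generalizing x with
  | zero => exact ⟨0, hk⟩
  | succ k ih =>
    rw [Function.iterate_succ_apply] at hk
    obtain ⟨j, hj⟩ := ih hk fun y hy => hx y (hy.trans (Anc.par _ _))
    refine ⟨j + 1, ?_⟩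
    have := hx x (Anc.refl _ _)
    rw [Function.iterate_succ_apply, exchange, if_neg this.1, if_neg this.2]
    exact hj

theorem isRooted : IsRooted (exchange par a b X Y) c := by
  refine ⟨?_, fun v => ?_⟩
  · rw [exchange, if_neg hE.root_notMem.1, if_neg hE.root_notMem.2, h.root]
  · obtain ⟨k, hk⟩ := h.reach v
    induction k generalizing v with
    | zero => exact ⟨0, hk⟩
    | succ k ih =>
      by_cases hX : v ∈ X
      · obtain ⟨i, hi⟩ := h.reach a
        obtain ⟨j, hj⟩ := reach_of_forall_notMem (a := a) (b := b) (X := X) (Y := Y) i hi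
          fun y => hE.notMem_of_anc_left h
        refine ⟨j + 1, ?_⟩
        rwa [Function.iterate_succ_apply, exchange, if_pos hX]
      by_cases hY : v ∈ Y
      · obtain ⟨i, hi⟩ := h.reach b
        obtain ⟨j, hj⟩ := reach_of_forall_notMem (a := a) (b := b) (X := X) (Y := Y) i hi
          fun y => hE.notMem_of_anc_right h
        refine ⟨j + 1, ?_⟩
        rwa [Function.iterate_succ_apply, exchange, if_neg hX, if_pos hY]
      · rw [Function.iterate_succ_apply] at hk
        obtain ⟨j, hj⟩ := ih _ hk
        refine ⟨j + 1, ?_⟩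
        rwa [Function.iterate_succ_apply, exchange, if_neg hX, if_neg hY]

omit h in
/-- Sums over children after an exchange. -/
theorem sum_children (f : V → ℤ) (v : V) :
    ∑ x ∈ children (exchange par a b X Y) c v, f x
      = ∑ x ∈ children par c v, f x + ((if v = a then 1 else 0) - (if v = b then 1 else 0))
          * (∑ x ∈ X, f x - ∑ x ∈ Y, f x) := by
  have hx : ∀ Z : Finset V, ∑ x ∈ Z, f x = ∑ x, if x ∈ Z then f x else 0 := fun Z => by simp
  rw [hx X, hx Y, hx (children _ _ _), hx (children _ _ _), ← Finset.sum_sub_distrib,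
    Finset.mul_sum, ← Finset.sum_add_distrib]
  refine Finset.sum_congr rfl fun x _ => ?_
  have hab := hE.ne
  by_cases hX : x ∈ X
  · obtain ⟨h1, h2⟩ := mem_children.1 (hE.left hX)
    have hY : x ∉ Y := fun hY => hab ((mem_children.1 (hE.right hY)).2.symm.trans h2)
    simp only [mem_children, exchange, if_pos hX, if_neg hY, h1, h2, ne_eq, not_false_eq_true,
      true_and]
    by_cases hva : v = a
    · subst hva; simp [hab, Ne.symm hab]
    · by_cases hvb : v = b
      · subst hvb; simp [hab, hva]
      · simp [hva, hvb, Ne.symm hva, Ne.symm hvb]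
  by_cases hY : x ∈ Y
  · obtain ⟨h1, h2⟩ := mem_children.1 (hE.right hY)
    simp only [mem_children, exchange, if_pos hY, if_neg hX, h1, h2, ne_eq, not_false_eq_true,
      true_and]
    by_cases hva : v = a
    · subst hva; simp [hab, Ne.symm hab]
    · by_cases hvb : v = b
      · subst hvb; simp [hab, hva]
      · simp [hva, hvb, Ne.symm hva, Ne.symm hvb]
  · simp [mem_children, exchange, hX, hY]

omit h in
theorem card_children (v : V) :
    ((children (exchange par a b X Y) c v).card : ℤ)
      = (children par c v).card + ((if v = a then 1 else 0) - (if v = b then 1 else 0))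
          * ((X.card : ℤ) - Y.card) := by
  simpa using hE.sum_children (fun _ => 1) v

/-- Only vertices above exactly one of `a` and `b` change size. The right-hand side satisfies the
child recursion of the new tree, and that recursion has a unique solution. -/
theorem size_exchange (v : V) :
    (size (exchange par a b X Y) v : ℤ)
      = size par v + (∑ x ∈ X, (size par x : ℤ) - ∑ x ∈ Y, (size par x : ℤ))
          * ((if Anc par v a then 1 else 0) - (if Anc par v b then 1 else 0)) := by
  set D : ℤ := ∑ x ∈ X, (size par x : ℤ) - ∑ x ∈ Y, (size par x : ℤ) with hD
  symm
  refine (hE.isRooted h).eq_size_of_recursion (f := fun v => size par v + D *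
    ((if Anc par v a then 1 else 0) - (if Anc par v b then 1 else 0))) (fun v => ?_) v
  rw [hE.sum_children]
  have hmem : ∀ x ∈ X ∪ Y, ((size par x : ℤ) + D *
      ((if Anc par x a then 1 else 0) - (if Anc par x b then 1 else 0))) = size par x := by
    intro x hx
    have h1 : ¬ Anc par x a := fun h' => by
      have := hE.notMem_of_anc_left h h'
      rw [Finset.mem_union] at hx
      tauto
    have h2 : ¬ Anc par x b := fun h' => by
      have := hE.notMem_of_anc_right h h'
      rw [Finset.mem_union] at hx
      tauto
    simp [h1, h2]
  rw [Finset.sum_congr rfl fun x hx => hmem x (Finset.mem_union_left _ hx),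
    Finset.sum_congr rfl fun x hx => hmem x (Finset.mem_union_right _ hx), ← hD,
    Finset.sum_add_distrib, ← Finset.mul_sum, Finset.sum_sub_distrib, Finset.sum_boole,
    Finset.sum_boole, h.card_children_anc, h.card_children_anc, h.size_eq v]
  have key : ∀ u : V, (((if Anc par v u ∧ v ≠ u then 1 else 0 : ℕ)) : ℤ)
      = (if Anc par v u then 1 else 0) - (if v = u then 1 else 0) := by
    intro u
    by_cases hu : v = u
    · subst hu; simp [Anc.refl]
    · simp [hu]
  rw [key, key]
  push_cast
  ring

end Exchangeable

/-! ### Dominance, concavity and the exchange inequality. -/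

/-- `a` dominates `b` if every iterated parent of `a` has at least as many descendants as the
corresponding iterated parent of `b`. -/
def Dominates {V : Type*} [Fintype V] (par : V → V) (a b : V) : Prop :=
  ∀ k, size par (par^[k] b) ≤ size par (par^[k] a)

/-- A strictly concave symmetric function on `{0, …, n}`. -/
structure StrictConcaveSymm (n : ℕ) (φ : ℕ → ℝ) : Prop where
  symm : ∀ x ≤ n, φ (n - x) = φ x
  spread : ∀ x y d, x ≤ y → 0 < d → y + d ≤ n → d ≤ x → φ (x - d) + φ (y + d) < φ x + φ y

/-- Spreading the pair y, n − y by y − x gives the pair x, n − x; symmetry turns the inequality into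
2φ(x) < 2φ(y). -/
theorem StrictConcaveSymm.lt {n : ℕ} {φ : ℕ → ℝ} (hφ : StrictConcaveSymm n φ) {x y : ℕ}
    (hxy : x < y) (hy : 2 * y ≤ n) : φ x < φ y := by
  have := hφ.spread y (n - y) (y - x) (by omega) (by omega) (by omega) (by omega)
  rw [show y - (y - x) = x by omega, show n - y + (y - x) = n - x by omega,
    hφ.symm x (by omega), hφ.symm y (by omega)] at this
  linarith

/-- The sum of the weights `φ` of the edges of a rooted tree. -/
noncomputable def edgeSum {V : Type*} [Fintype V] (φ : ℕ → ℝ) (par : V → V) (c : V) : ℝ :=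
  ∑ v ∈ Finset.univ.erase c, φ (size par v)

/-- Sizes grow by d on the part of the path from `a` that misses `b`, and shrink by d on the part of
the path from `b` that misses `a`. By dominance, each k-th vertex of the first part is paired with
the k-th vertex of the second, and the pair is spread apart, which lowers φ. An unpaired vertex
above `b` has size at most n/2, where φ increases, so shrinking it lowers φ too. -/
theorem Exchangeable.edgeSum_lt {V : Type*} [Fintype V] {par : V → V} {c a b : V} {X Y : Finset V}
    (h : IsRooted par c) (hE : Exchangeable par c a b X Y) {φ : ℕ → ℝ}
    (hφ : StrictConcaveSymm (Fintype.card V) φ)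
    (hbal : ∀ v, v ≠ c → 2 * size par v ≤ Fintype.card V) (hdom : Dominates par a b)
    (hlt : ∑ y ∈ Y, size par y < ∑ x ∈ X, size par x) :
    edgeSum φ (exchange par a b X Y) c < edgeSum φ par c := by
  obtain ⟨D, hD⟩ := Nat.exists_eq_add_of_lt hlt
  set d := D + 1 with hd
  have hsize := hE.size_exchange h
  have hDd : (∑ x ∈ X, (size par x : ℤ) - ∑ x ∈ Y, (size par x : ℤ)) = d := by
    rw [← Nat.cast_sum, ← Nat.cast_sum, hD, hd]
    push_cast
    ring
  rw [hDd] at hsize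
  set s := size par with hs
  set s' := size (exchange par a b X Y) with hs'
  have sA : ∀ v, Anc par v a → ¬ Anc par v b → s' v = s v + d := by
    intro v h1 h2
    have := hsize v
    rw [if_pos h1, if_neg h2] at this
    omega
  have sB : ∀ v, Anc par v b → ¬ Anc par v a → s' v + d = s v := by
    intro v h1 h2
    have := hsize v
    rw [if_pos h1, if_neg h2] at this
    omega
  have sC : ∀ v, (Anc par v a ↔ Anc par v b) → s' v = s v := by
    intro v h1
    have := hsize v
    simp only [h1, sub_self, mul_zero, add_zero, Nat.cast_inj] at this
    exact this
  -- A common bound lets both paths be indexed by the same range; indices beyond the depth give the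
  -- root, which the filters discard.
  set N := h.depth a + h.depth b + 1 with hN
  -- the proper ancestors of `u` that are not ancestors of `w`, listed from below
  have hsum : ∀ u w : V, h.depth u ≤ N → ∀ f : V → ℝ,
      ∑ v ∈ Finset.univ.filter (fun v => Anc par v u ∧ ¬ Anc par v w), f v
        = ∑ k ∈ (Finset.range N).filter (fun k => ¬ Anc par (par^[k] u) w), f (par^[k] u) := by
    intro u w hu f
    symm
    refine Finset.sum_bij (fun k _ => par^[k] u) ?_ ?_ ?_ ?_
    · intro k hk
      simp only [Finset.mem_filter, Finset.mem_univ, true_and] at hk ⊢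
      exact ⟨Anc.iterate _ _ _, hk.2⟩
    · intro i hi j hj hij
      simp only [Finset.mem_filter] at hi hj
      have key : ∀ k, ¬ Anc par (par^[k] u) w → k < h.depth u := fun k hk => by
        by_contra! hle
        rw [h.iterate_of_depth_le hle] at hk
        exact hk (h.anc_root _)
      have h1 := key i hi.2
      have h2 := key j hj.2
      have h3 := congrArg h.depth hij
      rw [h.depth_iterate, h.depth_iterate] at h3
      omega
    · intro v hv
      simp only [Finset.mem_filter, Finset.mem_univ, true_and] at hv
      have h1 := h.iterate_of_anc hv.1
      have h3 : h.depth v ≠ 0 := fun h0 => hv.2 (by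
        rw [h.depth_eq_zero.1 h0]; exact h.anc_root _)
      have h4 := h.depth_le_of_anc hv.1
      refine ⟨h.depth u - h.depth v, ?_, h1⟩
      simp only [Finset.mem_filter, Finset.mem_range]
      rw [h1]
      exact ⟨by omega, hv.2⟩
    · intros; rfl
  have hroot : s' c = s c := sC c (iff_of_true (h.anc_root _) (h.anc_root _))
  have htotal : edgeSum φ (exchange par a b X Y) c - edgeSum φ par c
      = ∑ v ∈ Finset.univ.filter (fun v => Anc par v a ∧ ¬ Anc par v b), (φ (s' v) - φ (s v))
        + ∑ v ∈ Finset.univ.filter (fun v => Anc par v b ∧ ¬ Anc par v a),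
            (φ (s' v) - φ (s v)) := by
    rw [edgeSum, edgeSum, ← Finset.sum_sub_distrib, Finset.sum_erase _ (by rw [← hs, ← hs', hroot, sub_self]),
      Finset.sum_filter, Finset.sum_filter, ← Finset.sum_add_distrib]
    refine Finset.sum_congr rfl fun v _ => ?_
    by_cases h1 : Anc par v a <;> by_cases h2 : Anc par v b
    · simp [h1, h2, ← hs, ← hs', sC v (iff_of_true h1 h2)]
    · simp [h1, h2, ← hs, ← hs']
    · simp [h1, h2, ← hs, ← hs']
    · simp [h1, h2, ← hs, ← hs', sC v (iff_of_false h1 h2)]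
  have hba : ¬ Anc par b a := fun hba => by
    have h1 := h.size_lt_of_anc hba (Ne.symm hE.ne)
    have h2 := hdom 0
    simp only [Function.iterate_zero, id] at h2
    omega
  -- The growing indices are among the shrinking ones: otherwise the k-th ancestor of `b` would lie
  -- strictly above that of `a` and be larger, against dominance.
  have hsub : (Finset.range N).filter (fun k => ¬ Anc par (par^[k] a) b)
      ⊆ (Finset.range N).filter (fun k => ¬ Anc par (par^[k] b) a) := by
    intro k hk
    simp only [Finset.mem_filter] at hk ⊢
    refine ⟨hk.1, fun hanc => ?_⟩
    rcases hanc.comparable (Anc.iterate par k a) with h1 | h1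
    · have hne : par^[k] b ≠ par^[k] a := fun he => hk.2 (he ▸ Anc.iterate par k b)
      have := h.size_lt_of_anc h1 hne
      have := hdom k
      omega
    · exact hk.2 (h1.trans (Anc.iterate _ _ _))
  have hneg : ∀ k, ¬ Anc par (par^[k] b) a →
      φ (s' (par^[k] b)) - φ (s (par^[k] b)) < 0 := by
    intro k hk
    have h1 := sB _ (Anc.iterate par k b) hk
    have h2 : par^[k] b ≠ c := fun he => hk (by rw [he]; exact h.anc_root _)
    have := hφ.lt (x := s' (par^[k] b)) (y := s (par^[k] b)) (by omega) (hbal _ h2)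
    linarith
  have hpair : ∀ k, ¬ Anc par (par^[k] b) a → ¬ Anc par (par^[k] a) b →
      (φ (s' (par^[k] a)) - φ (s (par^[k] a))) + (φ (s' (par^[k] b)) - φ (s (par^[k] b))) < 0 := by
    intro k hk hk'
    have h1 := sB _ (Anc.iterate par k b) hk
    have h2 := sA _ (Anc.iterate par k a) hk'
    have h3 : s' (par^[k] a) ≤ Fintype.card V := IsRooted.size_le_card _
    have := hφ.spread (s (par^[k] b)) (s (par^[k] a)) d (hdom k) (by omega) (by omega) (by omega)
    rw [← h2, show s (par^[k] b) - d = s' (par^[k] b) by omega] at this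
    linarith
  rw [← sub_neg, htotal, hsum a b (by omega), hsum b a (by omega), ← Finset.sum_sdiff hsub,
    add_comm, add_assoc, ← Finset.sum_add_distrib]
  have hle1 : ∑ k ∈ (Finset.range N).filter (fun k => ¬ Anc par (par^[k] b) a)
      \ (Finset.range N).filter (fun k => ¬ Anc par (par^[k] a) b),
      (φ (s' (par^[k] b)) - φ (s (par^[k] b))) ≤ 0 :=
    Finset.sum_nonpos fun k hk =>
      (hneg k (Finset.mem_filter.1 (Finset.mem_sdiff.1 hk).1).2).le
  have hpair' : ∀ k ∈ (Finset.range N).filter (fun k => ¬ Anc par (par^[k] a) b),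
      (φ (s' (par^[k] b)) - φ (s (par^[k] b))) + (φ (s' (par^[k] a)) - φ (s (par^[k] a))) < 0 :=
    fun k hk => by
      have := hpair k (Finset.mem_filter.1 (hsub hk)).2 (Finset.mem_filter.1 hk).2
      linarith
  have hzero : 0 ∈ (Finset.range N).filter (fun k => ¬ Anc par (par^[k] b) a) := by
    simp only [Finset.mem_filter, Finset.mem_range]
    exact ⟨by omega, hba⟩
  -- Index 0 always shrinks. It supplies the strict inequality as a pair, or as an unpaired term
  -- when `a` is an ancestor of `b`.
  by_cases h0 : 0 ∈ (Finset.range N).filter (fun k => ¬ Anc par (par^[k] a) b)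
  · have := Finset.sum_lt_sum_of_nonempty ⟨0, h0⟩ hpair'
    rw [Finset.sum_const_zero] at this
    linarith
  · have h1 := Finset.sum_nonpos fun k hk => (hpair' k hk).le
    have h2 : ∑ k ∈ (Finset.range N).filter (fun k => ¬ Anc par (par^[k] b) a)
        \ (Finset.range N).filter (fun k => ¬ Anc par (par^[k] a) b),
        (φ (s' (par^[k] b)) - φ (s (par^[k] b))) < 0 := by
      refine Finset.sum_neg (fun k hk =>
        (hneg k (Finset.mem_filter.1 (Finset.mem_sdiff.1 hk).1).2)) ⟨0, ?_⟩
      exact Finset.mem_sdiff.2 ⟨hzero, h0⟩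
    linarith

/-! ### Structure of optimal trees: the order by dominance. -/

/-- The degree of `v` in the rooted tree with parent function `par` and root `c`. -/
noncomputable def rootedDegree {V : Type*} [Fintype V] (par : V → V) (c v : V) : ℕ :=
  (children par c v).card + if v = c then 0 else 1

/-- `par` minimises the edge sum among the trees with the same root and degrees. -/
def IsOptimal {V : Type*} [Fintype V] (φ : ℕ → ℝ) (par : V → V) (c : V) : Prop :=
  ∀ par' : V → V, IsRooted par' c →
    Finset.univ.val.map (rootedDegree par' c) = Finset.univ.val.map (rootedDegree par c) →
    edgeSum φ par c ≤ edgeSum φ par' c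

theorem dominates_par {V : Type*} [Fintype V] {par : V → V} {a b : V} (h : Dominates par a b) :
    Dominates par (par a) (par b) := fun k => by
  simpa only [Function.iterate_succ_apply] using h (k + 1)

theorem Dominates.refl {V : Type*} [Fintype V] (par : V → V) (a : V) : Dominates par a a :=
  fun _ => le_rfl

theorem Dominates.trans {V : Type*} [Fintype V] {par : V → V} {a b d : V}
    (h₁ : Dominates par a b) (h₂ : Dominates par b d) : Dominates par a d :=
  fun k => (h₂ k).trans (h₁ k)

/-- The number of vertices dominated by `u`. -/
noncomputable def domRank {V : Type*} [Fintype V] (par : V → V) (u : V) : ℕ :=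
  Finset.card {w | Dominates par u w}

theorem dominates_of_size_le {V : Type*} [Fintype V] {par : V → V} {a b : V}
    (h : Dominates par (par a) (par b)) (h0 : size par b ≤ size par a) : Dominates par a b := by
  intro k
  cases k with
  | zero => exact h0
  | succ k => simpa only [Function.iterate_succ_apply] using h k

/-- A number that compares vertices by the labels of their ancestors up to the `j`-th, those
closest to the root first. -/
def pathKey {V : Type*} (par : V → V) (M : ℕ) (ι : V → ℕ) : ℕ → V → ℕ
  | 0, u => ι u
  | j + 1, u => M * pathKey par M ι j (par u) + ι u

section pathKey

variable {V : Type*} {par : V → V} {M : ℕ} {ι : V → ℕ} (hι : ∀ u, ι u < M)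

include hι

theorem pathKey_mod (j : ℕ) (u : V) : pathKey par M ι j u % M = ι u := by
  cases j with
  | zero => exact Nat.mod_eq_of_lt (hι u)
  | succ j => rw [pathKey, Nat.mul_add_mod, Nat.mod_eq_of_lt (hι u)]

theorem pathKey_div (j : ℕ) (u : V) :
    pathKey par M ι (j + 1) u / M = pathKey par M ι j (par u) := by
  rw [pathKey, Nat.mul_add_div (by have := hι u; omega), Nat.div_eq_of_lt (hι u), add_zero]

omit hι in
-- The recursion appends a last digit in base `M`; here the leading digit is split off instead.
theorem pathKey_succ (j : ℕ) (u : V) :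
    pathKey par M ι (j + 1) u = M ^ (j + 1) * ι (par^[j + 1] u) + pathKey par M ι j u := by
  induction j generalizing u with
  | zero => simp [pathKey]
  | succ j ih =>
    rw [pathKey, ih, pathKey, Function.iterate_succ_apply par (j + 1)]
    ring

/-- Adding one more leading digit, the label of `c` for both vertices, preserves the comparison;
dropping the last digit then leaves the keys of the parents. -/
theorem pathKey_par_le {c : V} {j : ℕ} (hj : ∀ u, par^[j] u = c) {u w : V}
    (huw : pathKey par M ι j u ≤ pathKey par M ι j w) :
    pathKey par M ι j (par u) ≤ pathKey par M ι j (par w) := by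
  rw [← pathKey_div hι, ← pathKey_div hι]
  apply Nat.div_le_div_right
  rw [pathKey_succ, pathKey_succ, Function.iterate_succ_apply, Function.iterate_succ_apply, hj, hj]
  omega

end pathKey

section optimal

variable {V : Type*} [Fintype V] {par : V → V} {c : V} (h : IsRooted par c)

open IsRooted

include h

theorem dominates_root (a : V) : Dominates par c a := fun k => by
  rw [h.iterate_root, h.size_root]
  exact size_le_card _

variable {φ : ℕ → ℝ} (hφ : StrictConcaveSymm (Fintype.card V) φ)
  (hbal : ∀ v, v ≠ c → 2 * size par v ≤ Fintype.card V) (hopt : IsOptimal φ par c)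

include hφ hbal hopt

/-- Otherwise swapping `x` and `y` keeps all degrees and lowers the edge sum. The swap is
legitimate: `x` above `a` would make `b` larger than `a`, and `y` above `b` would make `y` larger
than `x`. -/
theorem size_le_of_dominates {a b x y : V} (hab : Dominates par a b) (hne : a ≠ b)
    (hx : x ∈ children par c b) (hy : y ∈ children par c a) : size par x ≤ size par y := by
  by_contra! hlt
  rw [mem_children] at hx hy
  have hxb := h.size_lt_size_par hx.1
  rw [hx.2] at hxb
  have hE : Exchangeable par c a b {x} {y} := by
    refine ⟨hne, by simpa [mem_children] using hx, by simpa [mem_children] using hy, ?_, ?_⟩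
    · intro z hz hza
      rw [Finset.mem_singleton] at hz
      subst hz
      have h1 : Anc par b a := by
        rw [← hx.2]
        exact (Anc.par _ _).trans hza
      have := h.size_lt_of_anc h1 hne.symm
      have := hab 0
      simp only [Function.iterate_zero, id] at this
      omega
    · intro z hz hza
      rw [Finset.mem_singleton] at hz
      subst hz
      have := size_le_of_anc hza
      omega
  have h1 := hE.edgeSum_lt h hφ hbal hab (by simpa using hlt)
  have h2 := hopt _ (hE.isRooted h) (by
    congr 1
    ext v
    have := hE.card_children v
    simp only [Finset.card_singleton, sub_self, mul_zero, add_zero, Nat.cast_inj] at this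
    rw [rootedDegree, rootedDegree, this])
  linarith

/-- Otherwise moving the surplus of deg b − deg a children from `b` to `a` interchanges the two
degrees, keeps the degree multiset and lowers the edge sum. -/
theorem rootedDegree_le_of_dominates {a b : V} (hab : Dominates par a b) :
    rootedDegree par c b ≤ rootedDegree par c a := by
  rcases eq_or_ne a b with rfl | hne
  · rfl
  by_contra! hlt
  have hba : ¬ Anc par b a := fun hba => by
    have h1 := h.size_lt_of_anc hba hne.symm
    have h2 := hab 0
    simp only [Function.iterate_zero, id] at h2
    omega
  have hbc : b ≠ c := fun hb => hba (hb ▸ h.anc_root a)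
  -- As `b` is not the root it has deg b − 1 children, so deg a ≥ 1 ensures that there are enough of
  -- them to move.
  have hpos : 1 ≤ rootedDegree par c a := by
    rw [rootedDegree]
    split_ifs with hac
    · subst hac
      obtain ⟨y, hy1, hy2, -⟩ := h.exists_child_anc (h.anc_root b) hne
      have := Finset.card_pos.2 ⟨y, mem_children.2 ⟨hy1, hy2⟩⟩
      omega
    · omega
  obtain ⟨X, hXb, hXc⟩ : ∃ X ⊆ children par c b,
      X.card = rootedDegree par c b - rootedDegree par c a := by
    apply Finset.exists_subset_card_eq
    have : rootedDegree par c b = (children par c b).card + 1 := by rw [rootedDegree, if_neg hbc]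
    omega
  have hE : Exchangeable par c a b X ∅ := by
    refine ⟨hne, hXb, by simp, ?_, by simp⟩
    intro x hx hxa
    have hx := mem_children.1 (hXb hx)
    apply hba
    rw [← hx.2]
    exact (Anc.par _ _).trans hxa
  have h1 := hE.edgeSum_lt h hφ hbal hab (by
    rw [Finset.sum_empty]
    refine Finset.sum_pos (fun x _ => size_pos x) (Finset.card_pos.1 (by omega)))
  have h2 := hopt _ (hE.isRooted h) (by
    have hd : rootedDegree (exchange par a b X ∅) c
        = rootedDegree par c ∘ Equiv.swap a b := by
      ext v
      have hv := hE.card_children v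
      have hX : (X.card : ℤ) = rootedDegree par c b - rootedDegree par c a := by omega
      rw [hX] at hv
      simp only [Finset.card_empty, Nat.cast_zero, sub_zero] at hv
      have hv' : (rootedDegree (exchange par a b X ∅) c v : ℤ) = rootedDegree par c v
          + ((if v = a then 1 else 0) - (if v = b then 1 else 0))
          * ((rootedDegree par c b : ℤ) - rootedDegree par c a) := by
        rw [rootedDegree, rootedDegree.eq_1 par c v]
        push_cast
        rw [hv]
        ring
      rw [Function.comp_apply]
      by_cases hva : v = a
      · subst hva
        rw [Equiv.swap_apply_left]
        simp only [if_true, if_neg hne] at hv'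
        omega
      · by_cases hvb : v = b
        · subst hvb
          rw [Equiv.swap_apply_right]
          simp only [if_true, if_neg hva] at hv'
          omega
        · rw [Equiv.swap_apply_of_ne_of_ne hva hvb]
          simp only [if_neg hva, if_neg hvb] at hv'
          omega
    rw [hd, ← Multiset.map_map]
    congr 1
    exact congrArg Finset.val (Finset.map_univ_equiv (Equiv.swap a b)))
  linarith

/-- Induction towards the root: distinct parents are comparable, and by `size_le_of_dominates` the
sizes of their children follow the same order. With a common parent, sizes decide. -/
theorem dominates_total (u w : V) : Dominates par u w ∨ Dominates par w u := by
  obtain ⟨k, hk⟩ := h.reach u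
  induction k generalizing u w with
  | zero =>
    rw [Function.iterate_zero, id] at hk
    subst hk
    exact Or.inl (dominates_root h w)
  | succ k ih =>
    rw [Function.iterate_succ_apply] at hk
    by_cases hu : u = c
    · subst hu
      exact Or.inl (dominates_root h w)
    by_cases hw : w = c
    · subst hw
      exact Or.inr (dominates_root h u)
    have hu' : u ∈ children par c (par u) := mem_children.2 ⟨hu, rfl⟩
    have hw' : w ∈ children par c (par w) := mem_children.2 ⟨hw, rfl⟩
    by_cases he : par u = par w
    · rcases le_total (size par u) (size par w) with hs | hs
      · exact Or.inr (dominates_of_size_le (he ▸ Dominates.refl _ _) hs)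
      · exact Or.inl (dominates_of_size_le (he ▸ Dominates.refl _ _) hs)
    rcases ih (par u) (par w) hk with hd | hd
    · exact Or.inl (dominates_of_size_le hd
        (size_le_of_dominates h hφ hbal hopt hd he hw' hu'))
    · exact Or.inr (dominates_of_size_le hd
        (size_le_of_dominates h hφ hbal hopt hd (Ne.symm he) hu' hw'))

theorem dominates_iff_domRank_le (u w : V) :
    Dominates par u w ↔ domRank par w ≤ domRank par u := by
  constructor
  · intro huw
    apply Finset.card_le_card
    intro x hx
    simp only [Finset.mem_filter, Finset.mem_univ, true_and] at hx ⊢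
    exact huw.trans hx
  · intro hle
    by_contra hn
    have hwu := (dominates_total h hφ hbal hopt u w).resolve_left hn
    have : domRank par u < domRank par w := by
      apply Finset.card_lt_card
      rw [Finset.ssubset_iff_of_subset]
      · exact ⟨w, by simpa using Dominates.refl par w, by simpa using hn⟩
      · intro x hx
        simp only [Finset.mem_filter, Finset.mem_univ, true_and] at hx ⊢
        exact hwu.trans hx
    omega

/-- An optimal tree has a breadth-first order with non-increasing degrees. -/
theorem exists_order : ∃ e : V ≃ Fin (Fintype.card V),
    (∀ u w, e u ≤ e w → rootedDegree par c w ≤ rootedDegree par c u) ∧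
    (∀ u w, e u ≤ e w → e (par u) ≤ e (par w)) ∧ ∀ u, u ≠ c → e (par u) < e u := by
  set ι : V → ℕ := fun u => Fintype.equivFin V u with hι
  have hιM : ∀ u, ι u < Fintype.card V := fun u => (Fintype.equivFin V u).isLt
  have hιinj : Function.Injective ι := Fin.val_injective.comp (Fintype.equivFin V).injective
  obtain ⟨N, hN⟩ : ∃ N, ∀ u, par^[N] u = c :=
    ⟨∑ u, h.depth u, fun u => h.iterate_of_depth_le
      (Finset.single_le_sum (f := h.depth) (fun _ _ => Nat.zero_le _) (Finset.mem_univ u))⟩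
  set τ := pathKey par (Fintype.card V) ι N with hτ
  have hτinj : Function.Injective τ := fun u w huw => hιinj (by
    rw [← pathKey_mod hιM N u, ← pathKey_mod hιM N w]
    exact congrArg (· % Fintype.card V) huw)
  -- More dominant vertices come first. Ties are broken by ancestor labels read from the root down,
  -- so that siblings in a tie class stay together and the order passes to parents.
  set key : V → ℕᵒᵈ ×ₗ ℕ := fun u => toLex (OrderDual.toDual (domRank par u), τ u) with hkey
  have hinj : Function.Injective key := fun u w huw => hτinj (congrArg (fun p => (ofLex p).2) huw)
  let : LinearOrder V := LinearOrder.lift' key hinj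
  have hle : ∀ u w : V, u ≤ w ↔ domRank par w < domRank par u ∨
      domRank par u = domRank par w ∧ τ u ≤ τ w := by
    intro u w
    change key u ≤ key w ↔ _
    rw [hkey, Prod.Lex.toLex_le_toLex]
    simp
  have hdom : ∀ u w : V, u ≤ w → Dominates par u w := by
    intro u w huw
    rw [dominates_iff_domRank_le h hφ hbal hopt]
    rcases (hle u w).1 huw with h1 | h1
    · exact h1.le
    · exact h1.1.ge
  have hrank := dominates_iff_domRank_le h hφ hbal hopt
  have hpar : ∀ u w : V, u ≤ w → par u ≤ par w := by
    intro u w huw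
    have hd := dominates_par (hdom u w huw)
    by_cases hd' : Dominates par (par w) (par u)
    · have heq : domRank par (par u) = domRank par (par w) :=
        le_antisymm ((hrank _ _).1 hd') ((hrank _ _).1 hd)
      rcases (hle u w).1 huw with h1 | h1
      · have hn : ¬ Dominates par w u := fun h' => absurd ((hrank _ _).1 h') (by omega)
        have hu : u ≠ c ∨ u = c := ne_or_eq u c
        have hw : w ≠ c := fun hw => hn (hw ▸ dominates_root h u)
        rcases hu with hu | rfl
        · by_cases he : par u = par w
          · exact he.le
          · refine absurd (dominates_of_size_le hd' ?_) hn
            exact size_le_of_dominates h hφ hbal hopt hd' (Ne.symm he)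
              (mem_children.2 ⟨hu, rfl⟩) (mem_children.2 ⟨hw, rfl⟩)
        · have hs := hd' 0
          simp only [Function.iterate_zero, id] at hs
          rw [h.root, h.size_root] at hs
          by_cases hwu : par w = u
          · rw [hwu, h.root]
          · have := h.size_lt_of_anc (h.anc_root (par w)) (Ne.symm hwu)
            rw [h.size_root] at this
            omega
      · exact (hle _ _).2 (Or.inr ⟨heq, pathKey_par_le hιM hN h1.2⟩)
    · rw [hrank] at hd'
      exact (hle _ _).2 (Or.inl (by omega))
  have hlt : ∀ u, u ≠ c → par u < u := by
    intro u hu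
    have hn : ¬ Dominates par u (par u) := fun h' => by
      have := h' 0
      have := h.size_lt_size_par hu
      simp only [Function.iterate_zero, id] at *
      omega
    rw [hrank] at hn
    refine lt_of_le_of_ne ((hle _ _).2 (Or.inl (by omega))) (h.par_ne hu)
  let e := (Fintype.orderIsoFinOfCardEq V rfl).symm
  refine ⟨e.toEquiv, ?_, ?_, ?_⟩
  · intro u w huw
    exact rootedDegree_le_of_dominates h hφ hbal hopt (hdom u w (e.le_iff_le.1 huw))
  · intro u w huw
    exact e.le_iff_le.2 (hpar u w (e.le_iff_le.1 huw))
  · intro u hu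
    exact e.lt_iff_lt.2 (hlt u hu)

end optimal

/-! ### The graph of a parent function, and recognition of the greedy tree. -/

/-- The tree with parent function `par`. -/
def parentGraph {V : Type*} (par : V → V) : SimpleGraph V :=
  SimpleGraph.fromRel fun u v => par u = v

theorem parentGraph_adj {V : Type*} {par : V → V} {u v : V} :
    (parentGraph par).Adj u v ↔ u ≠ v ∧ (par u = v ∨ par v = u) := by
  simp [parentGraph]

theorem parentGraph_adj_iff {V : Type*} {par : V → V} {c : V} (h : IsRooted par c) {u v : V} :
    (parentGraph par).Adj u v ↔ (u ≠ c ∧ par u = v) ∨ (v ≠ c ∧ par v = u) := by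
  rw [parentGraph_adj]
  constructor
  · rintro ⟨hne, he | he⟩
    · exact Or.inl ⟨fun hu => hne (by rw [← he, hu, h.root]), he⟩
    · exact Or.inr ⟨fun hv => hne (by rw [← he, hv, h.root]), he⟩
  · rintro (⟨hu, he⟩ | ⟨hv, he⟩)
    · exact ⟨fun hne => h.par_ne hu (he.trans hne.symm), Or.inl he⟩
    · exact ⟨fun hne => h.par_ne hv (he.trans hne), Or.inr he⟩

section greedy

variable {V : Type*} [Fintype V] {par : V → V} {c : V} (h : IsRooted par c)
  {D : Multiset ℕ} (hD : Finset.univ.val.map (rootedDegree par c) = D)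
  (e : V ≃ Fin (Fintype.card V))
  (hdeg : ∀ u w, e u ≤ e w → rootedDegree par c w ≤ rootedDegree par c u)
  (hpar : ∀ u w, e u ≤ e w → e (par u) ≤ e (par w)) (hlt : ∀ u, u ≠ c → e (par u) < e u)

include hD in
theorem card_of_map_rootedDegree : D.card = Fintype.card V := by
  rw [← hD, Multiset.card_map]
  rfl

include hD hdeg in
theorem sortedDegree_eq (u : V) : sortedDegree D (e u) = rootedDegree par c u := by
  have hs : D.sort (· ≥ ·) = List.ofFn fun i => rootedDegree par c (e.symm i) := by
    have hperm : (D.sort (· ≥ ·)).Perm (List.ofFn fun i => rootedDegree par c (e.symm i)) := by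
      rw [← Multiset.coe_eq_coe, Multiset.sort_eq, ← hD, ← Function.comp_def (rootedDegree par c),
        ← List.map_ofFn, ← Multiset.map_coe]
      congr 1
      rw [List.ofFn_eq_map, ← Multiset.map_coe]
      exact (congrArg Finset.val (Finset.map_univ_equiv e.symm)).symm
    refine hperm.eq_of_pairwise (fun a b _ _ h1 h2 => le_antisymm h2 h1)
      (Multiset.pairwise_sort _ _) ?_
    rw [List.pairwise_ofFn]
    intro i j hij
    exact hdeg _ _ (by simpa using hij.le)
  rw [sortedDegree, hs, List.getD_eq_getElem _ _ (by simp)]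
  simp

include hlt in
theorem pos_root : (e c : ℕ) = 0 := by
  have hn : 0 < Fintype.card V := Fintype.card_pos_iff.2 ⟨c⟩
  by_contra hc
  have h1 : e.symm ⟨0, hn⟩ ≠ c := fun h' => hc (by rw [← h']; simp)
  have := hlt _ h1
  rw [Equiv.apply_symm_apply, Fin.lt_def] at this
  exact absurd this (Nat.not_lt_zero _)

include hD hdeg hlt in
-- Processing vertex i labels exactly its children: as many as its degree for the root, one fewer
-- otherwise.
theorem labelledCount_eq (i : ℕ) (hi : i ≤ Fintype.card V) :
    labelledCount D i
      = 1 + (Finset.univ.filter fun v : V => v ≠ c ∧ (e (par v) : ℕ) < i).card := by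
  induction i with
  | zero => simp [labelledCount]
  | succ i ih =>
    obtain ⟨u, hu⟩ : ∃ u, (e u : ℕ) = i := ⟨e.symm ⟨i, hi⟩, by simp⟩
    have hs := sortedDegree_eq hD e hdeg u
    rw [hu] at hs
    have hc : i = 0 ↔ u = c := by
      rw [← hu, ← pos_root e hlt, ← Fin.ext_iff, e.injective.eq_iff]
    have hsplit : (Finset.univ.filter fun v : V => v ≠ c ∧ (e (par v) : ℕ) < i + 1)
        = (Finset.univ.filter fun v : V => v ≠ c ∧ (e (par v) : ℕ) < i) ∪ children par c u := by
      ext v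
      simp only [Finset.mem_filter, Finset.mem_univ, true_and, Finset.mem_union,
        IsRooted.mem_children, ← and_or_left, Nat.lt_succ_iff_lt_or_eq, ← hu, ← Fin.ext_iff,
        e.injective.eq_iff]
    have hdisj : Disjoint (Finset.univ.filter fun v : V => v ≠ c ∧ (e (par v) : ℕ) < i)
        (children par c u) := by
      rw [Finset.disjoint_left]
      intro v hv hv'
      simp only [Finset.mem_filter, Finset.mem_univ, true_and] at hv
      rw [IsRooted.mem_children] at hv'
      rw [hv'.2] at hv
      omega
    rw [labelledCount, ih (by omega), hsplit, Finset.card_union_of_disjoint hdisj, ← add_assoc]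
    congr 1
    split_ifs with h0
    · subst h0
      rw [hs, rootedDegree, if_pos (hc.1 rfl), add_zero]
    · rw [hs, rootedDegree, if_neg (fun h' => h0 (hc.2 h')), Nat.add_sub_cancel]

include hD hdeg hlt hpar in
-- As `e` is monotone on parents, the root and the vertices whose parent comes before i form an
-- initial segment, whose length is the labelled count.
theorem lt_labelledCount_iff {i : ℕ} (hi : i ≤ Fintype.card V) {v : V} (hv : v ≠ c) :
    (e v : ℕ) < labelledCount D i ↔ (e (par v) : ℕ) < i := by
  rw [labelledCount_eq hD e hdeg hlt i hi]
  set A := Finset.univ.filter fun v : V => v ≠ c ∧ (e (par v) : ℕ) < i with hA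
  have hcA : c ∉ A := by simp [hA]
  have hlow : ∀ w, (Finset.univ.filter fun x : V => e x < e w).card = (e w : ℕ) := by
    intro w
    have : (Finset.univ.filter fun x : V => e x < e w) = (Finset.Iio (e w)).map e.symm.toEmbedding := by
      ext x
      simp
    rw [this, Finset.card_map, Fin.card_Iio]
  have hcv : e c < e v := by
    have h1 := pos_root e hlt
    have h2 : e c ≠ e v := fun h' => hv (e.injective h').symm
    rw [Fin.lt_def]
    rw [Ne, Fin.ext_iff] at h2
    omega
  constructor
  · intro hlt'
    by_contra hn
    have hsub : insert c A ⊆ Finset.univ.filter fun x : V => e x < e v := by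
      intro x hx
      rw [Finset.mem_insert] at hx
      simp only [Finset.mem_filter, Finset.mem_univ, true_and]
      rcases hx with rfl | hx
      · exact hcv
      · by_contra hxv
        have h1 := hpar _ _ (not_lt.1 hxv)
        simp only [hA, Finset.mem_filter, Finset.mem_univ, true_and] at hx
        rw [Fin.le_def] at h1
        omega
    have := Finset.card_le_card hsub
    rw [Finset.card_insert_of_notMem hcA, hlow] at this
    omega
  · intro hi'
    have hsub : (Finset.univ.filter fun x : V => e x < e v) ⊆ insert c (A.erase v) := by
      intro x hx
      simp only [Finset.mem_filter, Finset.mem_univ, true_and] at hx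
      rw [Finset.mem_insert, Finset.mem_erase]
      by_cases hxc : x = c
      · exact Or.inl hxc
      · refine Or.inr ⟨fun hxv => by simp [hxv] at hx, ?_⟩
        simp only [hA, Finset.mem_filter, Finset.mem_univ, true_and]
        have h1 := hpar _ _ hx.le
        rw [Fin.le_def] at h1
        exact ⟨hxc, by omega⟩
    have hvA : v ∈ A := by
      simp only [hA, Finset.mem_filter, Finset.mem_univ, true_and]
      exact ⟨hv, hi'⟩
    have := Finset.card_le_card hsub
    rw [hlow, Finset.card_insert_of_notMem (by simp [hA]), Finset.card_erase_of_mem hvA] at this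
    have := Finset.card_pos.2 ⟨v, hvA⟩
    omega

include h hD hdeg hpar hlt in
theorem nonempty_iso_greedyTree : Nonempty (parentGraph par ≃g greedyTree D) := by
  have hcard := card_of_map_rootedDegree hD
  have key : ∀ u v : V, (labelledCount D (e u) ≤ (e v : ℕ) ∧ (e v : ℕ) < labelledCount D (e u + 1))
      ↔ v ≠ c ∧ par v = u := by
    intro u v
    by_cases hv : v = c
    · have h1 := labelledCount_eq hD e hdeg hlt (e u) (e u).isLt.le
      have h2 := pos_root e hlt
      rw [hv, h2]
      simp only [ne_eq, not_true_eq_false, false_and, iff_false, not_and]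
      omega
    · rw [← not_lt, lt_labelledCount_iff hD e hdeg hpar hlt (e u).isLt.le hv,
        lt_labelledCount_iff hD e hdeg hpar hlt (e u).isLt hv, ← e.injective.eq_iff, Fin.ext_iff]
      simp only [ne_eq, hv, not_false_eq_true, true_and]
      omega
  refine ⟨⟨e.trans (finCongr hcard.symm), ?_⟩⟩
  intro u v
  rw [greedyTree, SimpleGraph.fromRel_adj, parentGraph_adj_iff h]
  simp only [Equiv.trans_apply, finCongr_apply, Fin.val_cast, key]
  rw [or_comm, and_iff_right_of_imp]
  rintro (⟨hu, he⟩ | ⟨hv, he⟩) heq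
  · exact h.par_ne hu (he.trans (e.injective (by simpa using heq)).symm)
  · exact h.par_ne hv (he.trans (e.injective (by simpa using heq)))

end greedy

/-! ### Trees are exactly the graphs of parent functions. -/

theorem parentGraph_adj_par {V : Type*} {par : V → V} {c : V} (h : IsRooted par c) {v : V}
    (hv : v ≠ c) : (parentGraph par).Adj v (par v) :=
  (parentGraph_adj_iff h).2 (Or.inl ⟨hv, rfl⟩)

theorem parentGraph_connected {V : Type*} {par : V → V} {c : V} (h : IsRooted par c) :
    (parentGraph par).Connected := by
  have hc : ∀ v, (parentGraph par).Reachable v c := by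
    intro v
    obtain ⟨k, hk⟩ := h.reach v
    induction k generalizing v with
    | zero => exact hk ▸ SimpleGraph.Reachable.refl _
    | succ k ih =>
      rw [Function.iterate_succ_apply] at hk
      by_cases hv : v = c
      · exact hv ▸ SimpleGraph.Reachable.refl _
      · exact (parentGraph_adj_par h hv).reachable.trans (ih _ hk)
  have : Nonempty V := ⟨c⟩
  exact ⟨fun u v => (hc u).trans (hc v).symm⟩

theorem parentEdge_injOn {V : Type*} {par : V → V} {c : V} (h : IsRooted par c) :
    Set.InjOn (fun v => s(v, par v)) {v | v ≠ c} := by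
  intro u hu v hv huv
  rw [Sym2.eq_iff] at huv
  rcases huv with huv | ⟨h1, h2⟩
  · exact huv.1
  · exact absurd (h1 ▸ Anc.par par v) (h2 ▸ h.not_anc_par hu)

theorem parentGraph_isTree {V : Type*} [Fintype V] {par : V → V} {c : V} (h : IsRooted par c) :
    (parentGraph par).IsTree := by
  have hconn := parentGraph_connected h
  rw [SimpleGraph.isTree_iff_connected_and_card]
  refine ⟨hconn, le_antisymm ?_ hconn.card_vert_le_card_edgeSet_add_one⟩
  have hsub : (parentGraph par).edgeSet ⊆ (fun v => s(v, par v)) '' {v | v ≠ c} := by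
    intro e
    induction e with
    | _ u v =>
      rw [SimpleGraph.mem_edgeSet, parentGraph_adj_iff h]
      rintro (⟨hu, rfl⟩ | ⟨hv, rfl⟩)
      · exact ⟨u, hu, rfl⟩
      · exact ⟨v, hv, Sym2.eq_swap⟩
  have h1 := Set.ncard_le_ncard hsub (Set.toFinite _)
  have h2 := Set.ncard_image_le (f := fun v => s(v, par v)) (Set.toFinite {v | v ≠ c})
  have h3 : {v | v ≠ c}.ncard + 1 = Nat.card V := by
    have := Set.ncard_add_ncard_compl ({c} : Set V)
    rw [Set.ncard_singleton] at this
    rw [← this, add_comm]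
    rfl
  rw [← h3, Nat.card_coe_set_eq]
  omega

/-- The parent of v is the next vertex on a shortest path to `c`. The resulting graph is a connected
subgraph of `T`, and a tree is minimal among connected graphs. -/
theorem exists_parentGraph_eq {V : Type*} [Fintype V] {T : SimpleGraph V} (hT : T.IsTree) (c : V) :
    ∃ par : V → V, IsRooted par c ∧ parentGraph par = T := by
  have hstep : ∀ v, ∃ u, (v = c → u = c) ∧ (v ≠ c → T.Adj v u ∧ T.dist u c + 1 = T.dist v c) := by
    intro v
    by_cases hv : v = c
    · exact ⟨c, fun _ => rfl, fun h => absurd hv h⟩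
    · obtain ⟨p, hp⟩ := hT.connected.exists_walk_length_eq_dist v c
      cases p with
      | nil => exact absurd rfl hv
      | @cons _ w _ hadj q =>
        refine ⟨w, fun h => absurd h hv, fun _ => ⟨hadj, ?_⟩⟩
        have h1 := SimpleGraph.dist_le q
        have h2 := hT.connected.dist_triangle (u := v) (v := w) (w := c)
        rw [SimpleGraph.dist_eq_one_iff_adj.2 hadj] at h2
        rw [SimpleGraph.Walk.length_cons] at hp
        omega
  choose par hroot hpar using hstep
  have h : IsRooted par c := by
    refine ⟨hroot c rfl, fun v => ?_⟩
    induction hd : T.dist v c generalizing v with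
    | zero => exact ⟨0, hT.connected.dist_eq_zero_iff.1 hd⟩
    | succ d ih =>
      have hv : v ≠ c := by
        rintro rfl
        simp at hd
      obtain ⟨k, hk⟩ := ih (par v) (by have := (hpar v hv).2; omega)
      exact ⟨k + 1, hk⟩
  refine ⟨par, h, ?_⟩
  have hle : parentGraph par ≤ T := by
    intro u v huv
    rcases (parentGraph_adj_iff h).1 huv with ⟨hu, rfl⟩ | ⟨hv, rfl⟩
    · exact (hpar u hu).1
    · exact (hpar v hv).1.symm
  exact le_antisymm hle
    ((SimpleGraph.isTree_iff_minimal_connected.1 hT).2 (parentGraph_connected h) hle)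

theorem degree_parentGraph {V : Type*} [Fintype V] {par : V → V} {c : V} (h : IsRooted par c)
    (v : V) : (parentGraph par).degree v = rootedDegree par c v := by
  have hset : (parentGraph par).neighborFinset v
      = children par c v ∪ (if v = c then ∅ else {par v}) := by
    ext u
    rw [SimpleGraph.mem_neighborFinset, parentGraph_adj_iff h, Finset.mem_union,
      IsRooted.mem_children]
    split_ifs with hv
    · simp [hv]
    · simp [hv, or_comm, eq_comm]
  rw [← SimpleGraph.card_neighborFinset_eq_degree, hset, Finset.card_union_of_disjoint,
    rootedDegree]
  · split_ifs <;> simp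
  · split_ifs with hv
    · exact Finset.disjoint_empty_right _
    · rw [Finset.disjoint_singleton_right, IsRooted.mem_children]
      rintro ⟨h1, h2⟩
      exact h.not_anc_par hv (by nth_rw 1 [← h2]; exact Anc.par _ _)

theorem hasDegreeSequence_parentGraph {V : Type*} [Fintype V] {par : V → V} {c : V}
    (h : IsRooted par c) {D : Multiset ℕ} :
    HasDegreeSequence (parentGraph par) D ↔ Finset.univ.val.map (rootedDegree par c) = D := by
  have : (fun v => (parentGraph par).degree v) = rootedDegree par c :=
    funext (degree_parentGraph h)
  rw [HasDegreeSequence, ← this]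

/-! ### Separating edges: Steiner distances, distances and the two indices. -/

/-- The vertices `v` such that the edge from `v` to its parent separates two elements of `S`. -/
noncomputable def separators {V : Type*} [Fintype V] (par : V → V) (S : Set V) : Finset V :=
  {v | (∃ x ∈ S, Anc par v x) ∧ ∃ y ∈ S, ¬ Anc par v y}

theorem mem_separators {V : Type*} [Fintype V] {par : V → V} {S : Set V} {v : V} :
    v ∈ separators par S ↔ (∃ x ∈ S, Anc par v x) ∧ ∃ y ∈ S, ¬ Anc par v y := by
  simp [separators]

section separators

variable {V : Type*} {par : V → V} {c : V} (h : IsRooted par c)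

include h

/-- The edge from `v` to its parent is the only one leaving the set of descendants of `v`, so every
connection out of that set uses it. -/
theorem eq_of_adj_of_anc {v p q : V} (hpq : (parentGraph par).Adj p q) (hp : Anc par v p)
    (hq : ¬ Anc par v q) : p = v ∧ q = par v := by
  rcases (parentGraph_adj_iff h).1 hpq with ⟨-, rfl⟩ | ⟨-, rfl⟩
  · by_cases hvp : v = p
    · exact ⟨hvp.symm, by rw [hvp]⟩
    · exact absurd (IsRooted.anc_par_of_ne hp hvp) hq
  · exact absurd (hp.trans (Anc.par _ _)) hq

variable [Fintype V]

theorem ne_root_of_mem_separators {S : Set V} {v : V} (hv : v ∈ separators par S) : v ≠ c := by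
  rintro rfl
  obtain ⟨y, _, hy⟩ := (mem_separators.1 hv).2
  exact hy (h.anc_root y)

theorem card_separators_le {S : Set V} {E : Set (Sym2 V)}
    (hE : ∀ v ∈ separators par S, s(v, par v) ∈ E) : (separators par S).card ≤ E.ncard := by
  rw [← Set.ncard_coe_finset, ← Set.InjOn.ncard_image
    ((parentEdge_injOn h).mono fun v hv => ne_root_of_mem_separators h hv)]
  refine Set.ncard_le_ncard ?_ (Set.toFinite _)
  rintro _ ⟨v, hv, rfl⟩
  exact hE v hv

theorem card_separators_le_of_subgraph {S : Set V} (H : (parentGraph par).Subgraph)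
    (hH : H.coe.Connected) (hS : S ⊆ H.verts) :
    (separators par S).card ≤ H.edgeSet.ncard := by
  refine card_separators_le h fun v hv => ?_
  obtain ⟨⟨x, hx, hvx⟩, y, hy, hvy⟩ := mem_separators.1 hv
  obtain ⟨p⟩ := hH.preconnected ⟨x, hS hx⟩ ⟨y, hS hy⟩
  obtain ⟨d, -, h1, h2⟩ := p.exists_boundary_dart {z | Anc par v z.1} hvx hvy
  have h3 : H.Adj d.fst.1 d.snd.1 := d.adj
  obtain ⟨h4, h5⟩ := eq_of_adj_of_anc h h3.adj_sub h1 h2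
  rw [h4, h5] at h3
  exact h3

/-- The smallest subtree containing a nonempty set of vertices. -/
theorem exists_subtree {S : Set V} (hS : S.Nonempty) :
    ∃ H : (parentGraph par).Subgraph, H.coe.IsTree ∧ S ⊆ H.verts ∧
      H.edgeSet.ncard = (separators par S).card := by
  -- A common ancestor of least size is the lowest one; the subtree consists of the paths from `z`
  -- down to `S`.
  obtain ⟨z, hz, hmin⟩ := Set.exists_min_image {v | ∀ x ∈ S, Anc par v x} (size par)
    (Set.toFinite _) ⟨c, fun x _ => h.anc_root x⟩
  set W : Set V := {v | Anc par z v ∧ ∃ x ∈ S, Anc par v x} with hW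
  set H : (parentGraph par).Subgraph := (⊤ : (parentGraph par).Subgraph).induce W with hH
  have hHadj : ∀ p q, H.Adj p q ↔ p ∈ W ∧ q ∈ W ∧ (parentGraph par).Adj p q := by
    intro p q
    rw [hH, SimpleGraph.Subgraph.induce_adj, SimpleGraph.Subgraph.top_adj]
  have hSW : S ⊆ H.verts := fun x hx => ⟨hz x hx, x, hx, Anc.refl _ _⟩
  obtain ⟨x₀, hx₀⟩ := hS
  have hzW : z ∈ W := ⟨Anc.refl _ _, x₀, hx₀, hz x₀ hx₀⟩
  have hreach : ∀ d, ∀ v (hv : v ∈ W), h.depth v = d →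
      H.coe.Reachable ⟨v, hv⟩ ⟨z, hzW⟩ := by
    intro d
    induction d with
    | zero =>
      intro v hv hd
      rw [h.depth_eq_zero] at hd
      subst hd
      have := h.anc_antisymm hv.1 (h.anc_root z)
      subst this
      exact SimpleGraph.Reachable.refl _
    | succ d ih =>
      intro v hv hd
      by_cases hzv : z = v
      · subst hzv
        exact SimpleGraph.Reachable.refl _
      have hvc : v ≠ c := fun hvc => by
        rw [hvc, h.depth_root] at hd
        omega
      obtain ⟨x, hx, hvx⟩ := hv.2
      have hp : par v ∈ W := ⟨IsRooted.anc_par_of_ne hv.1 hzv, x, hx, (Anc.par _ _).trans hvx⟩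
      have hadj : H.coe.Adj ⟨v, hv⟩ ⟨par v, hp⟩ :=
        (hHadj _ _).2 ⟨hv, hp, parentGraph_adj_par h hvc⟩
      exact hadj.reachable.trans (ih _ hp (by have := h.depth_par hvc; omega))
  have hconn : H.coe.Connected := by
    have : Nonempty H.verts := ⟨⟨z, hzW⟩⟩
    exact ⟨fun u v => (hreach _ u.1 u.2 rfl).trans (hreach _ v.1 v.2 rfl).symm⟩
  refine ⟨H, ⟨hconn, (parentGraph_isTree h).isAcyclic.subgraph H⟩, hSW, le_antisymm ?_
    (card_separators_le_of_subgraph h H hconn hSW)⟩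
  have hsep : ∀ v, v ≠ c → v ∈ W → par v ∈ W → v ∈ separators par S := by
    intro v hvc hv hpv
    refine mem_separators.2 ⟨hv.2, ?_⟩
    -- If all of `S` lay below v, then v would be a common ancestor smaller than `z`.
    by_contra! hall
    have hne : z ≠ v := fun hzv => h.not_anc_par hvc (hzv ▸ hpv.1)
    have := h.size_lt_of_anc hv.1 hne
    have := hmin v hall
    omega
  have hsub : H.edgeSet ⊆ (fun v => s(v, par v)) '' (separators par S : Set V) := by
    intro e
    induction e with
    | _ p q =>
      rw [SimpleGraph.Subgraph.mem_edgeSet, hHadj]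
      rintro ⟨hp, hq, hadj⟩
      rcases (parentGraph_adj_iff h).1 hadj with ⟨hpc, rfl⟩ | ⟨hqc, rfl⟩
      · exact ⟨p, hsep p hpc hp hq, rfl⟩
      · exact ⟨q, hsep q hqc hq hp, Sym2.eq_swap⟩
  calc H.edgeSet.ncard ≤ _ := Set.ncard_le_ncard hsub (Set.toFinite _)
    _ ≤ _ := Set.ncard_image_le (Set.toFinite _)
    _ = _ := Set.ncard_coe_finset _

theorem steinerDist_eq {S : Set V} (hS : S.Nonempty) :
    steinerDist (parentGraph par) S = (separators par S).card := by
  refine IsLeast.csInf_eq ⟨exists_subtree h hS, ?_⟩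
  rintro k ⟨H, hH, hSH, rfl⟩
  exact card_separators_le_of_subgraph h H hH.connected hSH

omit h in
theorem dist_le_of_subgraph {G : SimpleGraph V} (H : G.Subgraph) (hH : H.coe.Connected)
    {u w : V} (hu : u ∈ H.verts) (hw : w ∈ H.verts) : G.dist u w ≤ H.edgeSet.ncard := by
  obtain ⟨p, hp⟩ := (hH.preconnected ⟨u, hu⟩ ⟨w, hw⟩).exists_isPath
  have hq : (p.map H.hom).IsPath :=
    hp.map SimpleGraph.Subgraph.hom_injective
  refine (SimpleGraph.dist_le (p.map H.hom)).trans ?_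
  rw [← SimpleGraph.Walk.length_edges, ← List.toFinset_card_of_nodup hq.isTrail.edges_nodup,
    ← Set.ncard_coe_finset]
  refine Set.ncard_le_ncard ?_ (Set.toFinite _)
  intro e he
  rw [Finset.mem_coe, List.mem_toFinset, SimpleGraph.Walk.edges_map, List.mem_map] at he
  obtain ⟨e', he', rfl⟩ := he
  have := p.edges_subset_edgeSet he'
  revert this
  induction e' with
  | _ a b => exact fun hab => hab

/-- A path in the smallest subtree gives the upper bound; conversely every walk between `u` and `w`
crosses each separating edge. -/
theorem dist_eq (u w : V) :
    (parentGraph par).dist u w = (separators par {x | x ∈ s(u, w)}).card := by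
  apply le_antisymm
  · obtain ⟨H, hH, hS, hcard⟩ := exists_subtree h (S := {x | x ∈ s(u, w)}) ⟨u, by simp⟩
    rw [← hcard]
    exact dist_le_of_subgraph H hH.connected (hS (by simp)) (hS (by simp))
  · obtain ⟨p, hp⟩ := (parentGraph_connected h).exists_walk_length_eq_dist u w
    rw [← hp, ← SimpleGraph.Walk.length_edges]
    refine le_trans ?_ (List.toFinset_card_le _)
    rw [← Set.ncard_coe_finset p.edges.toFinset]
    refine card_separators_le h fun v hv => ?_
    rw [Finset.mem_coe, List.mem_toFinset]
    obtain ⟨⟨x, hx, hvx⟩, y, hy, hvy⟩ := mem_separators.1 hv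
    have key : ∀ (a b : V) (q : (parentGraph par).Walk a b), Anc par v a → ¬ Anc par v b →
        s(v, par v) ∈ q.edges := by
      intro a b q ha hb
      obtain ⟨d, hd, h1, h2⟩ := q.exists_boundary_dart {z | Anc par v z} ha hb
      obtain ⟨h4, h5⟩ := eq_of_adj_of_anc h d.adj h1 h2
      rw [← h5]
      nth_rw 1 [← h4]
      exact List.mem_map_of_mem hd
    rw [Set.mem_ofPred_eq, Sym2.mem_iff] at hx hy
    by_cases hu : Anc par v u
    · have hw : ¬ Anc par v w := by
        rcases hy with rfl | rfl
        · exact absurd hu hvy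
        · exact hvy
      exact key u w p hu hw
    · have hw : Anc par v w := by
        rcases hx with rfl | rfl
        · exact absurd hvx hu
        · exact hvx
      have := key w u p.reverse hw hu
      rwa [SimpleGraph.Walk.edges_reverse, List.mem_reverse] at this

omit h in
-- A set is not separated exactly when it lies among the descendants of `v` or in their complement;
-- r ≥ 1 excludes the empty set, which lies in both.
theorem card_powersetCard_separators {r : ℕ} (hr : 1 ≤ r) (v : V) :
    ((Finset.univ.powersetCard r).filter fun S : Finset V => v ∈ separators par (S : Set V)).card
        + ((size par v).choose r + (Fintype.card V - size par v).choose r)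
      = (Fintype.card V).choose r := by
  set A : Finset V := {x | Anc par v x} with hA
  have hmem : ∀ x, x ∈ A ↔ Anc par v x := fun x => by simp [hA]
  have hAc : Aᶜ.card = Fintype.card V - size par v := Finset.card_compl A
  have hdisj : Disjoint (A.powersetCard r) (Aᶜ.powersetCard r) := by
    rw [Finset.disjoint_left]
    intro S hS hS'
    rw [Finset.mem_powersetCard] at hS hS'
    obtain ⟨x, hx⟩ := Finset.card_pos.1 (by omega : 0 < S.card)
    exact Finset.mem_compl.1 (hS'.1 hx) (hS.1 hx)
  rw [← hAc, show size par v = A.card from rfl, ← Finset.card_powersetCard,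
    ← Finset.card_powersetCard r Aᶜ, ← Finset.card_union_of_disjoint hdisj, ← Finset.card_univ,
    ← Finset.card_powersetCard r Finset.univ, ← Finset.card_union_of_disjoint]
  · congr 1
    ext S
    simp only [Finset.mem_union, Finset.mem_filter, Finset.mem_powersetCard, Finset.subset_univ,
      true_and, mem_separators, Finset.mem_coe, ← hmem]
    constructor
    · rintro (h1 | h1 | h1)
      exacts [h1.1, h1.2, h1.2]
    · intro hS
      by_cases h1 : S ⊆ A
      · exact Or.inr (Or.inl ⟨h1, hS⟩)
      by_cases h2 : S ⊆ Aᶜ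
      · exact Or.inr (Or.inr ⟨h2, hS⟩)
      rw [Finset.not_subset] at h1 h2
      refine Or.inl ⟨hS, ?_, h1⟩
      obtain ⟨x, hx, hx'⟩ := h2
      exact ⟨x, hx, by simpa using hx'⟩
  · rw [Finset.disjoint_left]
    intro S hS hS'
    simp only [Finset.mem_union, Finset.mem_filter, Finset.mem_powersetCard,
      mem_separators, Finset.mem_coe, ← hmem] at hS hS'
    obtain ⟨-, ⟨x, hx, hxA⟩, y, hy, hyA⟩ := hS
    rcases hS' with h1 | h1
    · exact hyA (h1.1 hy)
    · exact Finset.mem_compl.1 (h1.1 hx) hxA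

/-- Double counting of pairs (set, separating edge). The root may be included, since its term
vanishes for r ≥ 1. -/
theorem steinerWiener_parentGraph {r : ℕ} (hr : 1 ≤ r) :
    (steinerWiener r (parentGraph par) : ℝ) = ∑ v : V, (((Fintype.card V).choose r : ℝ)
      - (size par v).choose r - (Fintype.card V - size par v).choose r) := by
  have h1 : steinerWiener r (parentGraph par)
      = ∑ v : V, ((Finset.univ.powersetCard r).filter
          fun S : Finset V => v ∈ separators par (S : Set V)).card := by
    simp only [Finset.card_filter]
    rw [Finset.sum_comm, steinerWiener]
    refine Finset.sum_congr rfl fun S hS => ?_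
    rw [steinerDist_eq h]
    · rw [← Finset.card_filter, Finset.filter_univ_mem]
    · rw [Finset.mem_powersetCard] at hS
      exact Finset.card_pos.1 (by omega)
  rw [h1, Nat.cast_sum]
  refine Finset.sum_congr rfl fun v _ => ?_
  rw [← card_powersetCard_separators (par := par) hr v]
  push_cast
  ring

omit h in
theorem card_sym2_separators (v : V) :
    (Finset.univ.filter fun p : Sym2 V => v ∈ separators par {x | x ∈ p}).card
      = size par v * (Fintype.card V - size par v) := by
  set A : Finset V := {x | Anc par v x} with hA
  have hmem : ∀ x, x ∈ A ↔ Anc par v x := fun x => by simp [hA]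
  have hAc : Aᶜ.card = Fintype.card V - size par v := Finset.card_compl A
  rw [← hAc, show size par v = A.card from rfl, ← Finset.card_product]
  symm
  refine Finset.card_bij (fun q _ => s(q.1, q.2)) ?_ ?_ ?_
  · rintro ⟨x, y⟩ hxy
    simp only [Finset.mem_product, Finset.mem_compl] at hxy
    simp only [Finset.mem_filter, Finset.mem_univ, true_and, mem_separators, ← hmem]
    exact ⟨⟨x, by simp, hxy.1⟩, y, by simp, hxy.2⟩
  · rintro ⟨x, y⟩ hxy ⟨x', y'⟩ hxy' heq
    simp only [Finset.mem_product, Finset.mem_compl] at hxy hxy'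
    rcases Sym2.eq_iff.1 heq with ⟨h1, h2⟩ | ⟨h1, h2⟩
    · exact Prod.ext h1 h2
    · exact absurd ((show x = y' from h1) ▸ hxy.1) hxy'.2
  · intro p hp
    simp only [Finset.mem_filter, Finset.mem_univ, true_and, mem_separators, ← hmem] at hp
    obtain ⟨⟨x, hx, hxA⟩, y, hy, hyA⟩ := hp
    have hne : x ≠ y := fun he => hyA (he ▸ hxA)
    refine ⟨(x, y), by simp [hxA, hyA], ?_⟩
    exact ((Sym2.mem_and_mem_iff hne).1 ⟨hx, hy⟩).symm

theorem wiener_parentGraph :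
    (wiener (parentGraph par) : ℝ)
      = ∑ v : V, (size par v : ℝ) * ((Fintype.card V - size par v : ℕ) : ℝ) := by
  have h1 : wiener (parentGraph par)
      = ∑ v : V, (Finset.univ.filter fun p : Sym2 V => v ∈ separators par {x | x ∈ p}).card := by
    simp only [Finset.card_filter]
    rw [Finset.sum_comm, wiener]
    refine Finset.sum_congr rfl fun p _ => ?_
    rw [← Finset.card_filter, Finset.filter_univ_mem]
    induction p with
    | _ u w => exact dist_eq h u w
  rw [h1, Nat.cast_sum]
  refine Finset.sum_congr rfl fun v _ => ?_
  rw [card_sym2_separators, Nat.cast_mul]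

end separators

/-! ### Concavity of the edge weight. -/

/-- The contribution to `SW_r + ε W` of an edge of a tree with `n` vertices that cuts off `x`
vertices. -/
noncomputable def edgeWeight (n r : ℕ) (ε : ℝ) (x : ℕ) : ℝ :=
  (n.choose r - x.choose r - (n - x).choose r) + ε * (x * ((n - x : ℕ) : ℝ))

/-- Convexity of the binomial coefficient: by Pascal's rule its increments are C(·, r−1), which are
monotone. -/
theorem choose_add_choose_le (r : ℕ) {x y : ℕ} (hxy : x ≤ y) (d : ℕ) (hd : d ≤ x) :
    x.choose r + y.choose r ≤ (x - d).choose r + (y + d).choose r := by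
  induction d with
  | zero => simp
  | succ d ih =>
    refine (ih (by omega)).trans ?_
    cases r with
    | zero => simp
    | succ r =>
      have h1 := Nat.choose_le_choose r (show x - (d + 1) ≤ y + d by omega)
      rw [show x - d = (x - (d + 1)) + 1 by omega, ← add_assoc y, Nat.choose_succ_succ',
        Nat.choose_succ_succ']
      omega

/-- Both binomial terms are only weakly concave (for r = 1 they cancel against C(n,1)); strictness
comes from ε x(n−x). -/
theorem strictConcaveSymm_edgeWeight (n r : ℕ) {ε : ℝ} (hε : 0 < ε) :
    StrictConcaveSymm n (edgeWeight n r ε) := by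
  refine ⟨fun x hx => ?_, fun x y d hxy hd hy hx => ?_⟩
  · rw [edgeWeight, edgeWeight, Nat.sub_sub_self hx]
    ring
  · have h1 := choose_add_choose_le r hxy d hx
    have h2 := choose_add_choose_le r (show n - y ≤ n - x by omega) d (by omega)
    rw [show n - y - d = n - (y + d) by omega, show n - x + d = n - (x - d) by omega] at h2
    have h1' : (x.choose r : ℝ) + y.choose r ≤ (x - d).choose r + (y + d).choose r := by
      exact_mod_cast h1
    have h2' : ((n - y).choose r : ℝ) + (n - x).choose r
        ≤ (n - (y + d)).choose r + (n - (x - d)).choose r := by exact_mod_cast h2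
    have h3 : ((x - d : ℕ) : ℝ) * ((n - (x - d) : ℕ) : ℝ) + ((y + d : ℕ) : ℝ)
        * ((n - (y + d) : ℕ) : ℝ) < (x : ℝ) * ((n - x : ℕ) : ℝ) + (y : ℝ) * ((n - y : ℕ) : ℝ) := by
      rw [Nat.cast_sub (by omega : x - d ≤ n), Nat.cast_sub hx, Nat.cast_sub hy,
        Nat.cast_sub (by omega : x ≤ n), Nat.cast_sub (by omega : y ≤ n)]
      push_cast
      have hd' : (0 : ℝ) < d := by exact_mod_cast hd
      have hxy' : (x : ℝ) ≤ y := by exact_mod_cast hxy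
      nlinarith [mul_pos hd' hd', mul_nonneg hd'.le (sub_nonneg.2 hxy')]
    have h4 := mul_lt_mul_of_pos_left h3 hε
    simp only [edgeWeight]
    linarith

theorem edgeSum_edgeWeight {V : Type*} [Fintype V] {par : V → V} {c : V} (h : IsRooted par c)
    {r : ℕ} (hr : 1 ≤ r) (ε : ℝ) :
    edgeSum (edgeWeight (Fintype.card V) r ε) par c
      = steinerWiener r (parentGraph par) + ε * wiener (parentGraph par) := by
  rw [steinerWiener_parentGraph h hr, wiener_parentGraph h, Finset.mul_sum,
    ← Finset.sum_add_distrib, edgeSum]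
  apply Finset.sum_erase
  rw [h.size_root, edgeWeight, Nat.sub_self, Nat.choose_eq_zero_of_lt (by omega : 0 < r)]
  simp

/-! ### Rerooting and the centroid. -/

/-- Moving the root to the child `y` of `c`. -/
noncomputable def reroot {V : Type*} (par : V → V) (c y : V) : V → V :=
  fun v => if v = y then y else if v = c then y else par v

section reroot

variable {V : Type*} {par : V → V} {c y : V} (h : IsRooted par c) (hyc : y ≠ c) (hy : par y = c)

include h in
theorem isRooted_reroot : IsRooted (reroot par c y) y := by
  refine ⟨by simp [reroot], fun v => ?_⟩
  obtain ⟨k, hk⟩ := h.reach v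
  induction k generalizing v with
  | zero =>
    rw [Function.iterate_zero, id] at hk
    exact ⟨1, by simp [reroot, hk]⟩
  | succ k ih =>
    rw [Function.iterate_succ_apply] at hk
    by_cases hvy : v = y
    · exact ⟨0, hvy⟩
    by_cases hvc : v = c
    · exact ⟨1, by simp [reroot, hvc]⟩
    · obtain ⟨j, hj⟩ := ih _ hk
      exact ⟨j + 1, by rw [Function.iterate_succ_apply, reroot, if_neg hvy, if_neg hvc, hj]⟩

include h hyc hy

theorem parentGraph_reroot : parentGraph (reroot par c y) = parentGraph par := by
  ext u v
  rw [parentGraph_adj_iff (isRooted_reroot h), parentGraph_adj_iff h]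
  have key : ∀ u v : V, (u ≠ y ∧ reroot par c y u = v) ↔
      (u = c ∧ v = y) ∨ (u ≠ c ∧ par u = v ∧ ¬ (u = y ∧ v = c)) := by
    intro u v
    rw [reroot]
    by_cases huy : u = y
    · subst huy
      simp [hyc, hy, eq_comm]
    · by_cases huc : u = c
      · subst huc
        simp [huy, eq_comm]
      · simp [huy, huc]
  have hc : (y ≠ c ∧ par y = c) := ⟨hyc, hy⟩
  rw [key, key]
  constructor
  · rintro ((⟨rfl, rfl⟩ | h1) | (⟨rfl, rfl⟩ | h1))
    exacts [Or.inr hc, Or.inl ⟨h1.1, h1.2.1⟩, Or.inl hc, Or.inr ⟨h1.1, h1.2.1⟩]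
  · rintro (h1 | h1)
    · by_cases hu : u = y ∧ v = c
      · exact Or.inr (Or.inl ⟨hu.2, hu.1⟩)
      · exact Or.inl (Or.inr ⟨h1.1, h1.2, hu⟩)
    · by_cases hv : v = y ∧ u = c
      · exact Or.inl (Or.inl ⟨hv.2, hv.1⟩)
      · exact Or.inr (Or.inr ⟨h1.1, h1.2, hv⟩)

variable [Fintype V]

theorem sum_children_reroot (f : V → ℤ) (v : V) :
    ∑ x ∈ children (reroot par c y) y v, f x
      = ∑ x ∈ children par c v, f x + (if v = y then f c else 0) - (if v = c then f y else 0) := by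
  by_cases hvy : v = y
  · have : children (reroot par c y) y v = insert c (children par c v) := by
      ext x
      rw [Finset.mem_insert, IsRooted.mem_children, IsRooted.mem_children, reroot, hvy]
      by_cases hxy : x = y
      · subst hxy
        simp [hyc, hy, Ne.symm hyc]
      · by_cases hxc : x = c
        · subst hxc; simp [hxy]
        · simp [hxy, hxc]
    rw [this, Finset.sum_insert (by simp [IsRooted.mem_children]), if_pos hvy,
      if_neg (hvy ▸ hyc)]
    ring
  · by_cases hvc : v = c
    · have : children par c v = insert y (children (reroot par c y) y v) := by
        ext x
        rw [Finset.mem_insert, IsRooted.mem_children, IsRooted.mem_children, reroot, hvc]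
        by_cases hxy : x = y
        · subst hxy
          simp [hyc, hy]
        · by_cases hxc : x = c
          · subst hxc; simp [hxy, hyc]
          · simp [hxy, hxc]
      rw [this, Finset.sum_insert (by simp [IsRooted.mem_children]), if_neg hvy, if_pos hvc]
      ring
    · have : children par c v = children (reroot par c y) y v := by
        ext x
        rw [IsRooted.mem_children, IsRooted.mem_children, reroot]
        by_cases hxy : x = y
        · subst hxy
          simp [hy, Ne.symm hvc]
        · by_cases hxc : x = c
          · subst hxc; simp [Ne.symm hvy]
          · simp [hxy, hxc]
      rw [this, if_neg hvy, if_neg hvc]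
      ring

/-- Only the two ends of the reversed edge change: `y` now has all vertices below it, and `c` loses
the branch at `y`. -/
theorem size_reroot (v : V) :
    (size (reroot par c y) v : ℤ) = size par v
      + (if v = y then (Fintype.card V : ℤ) - size par y else 0)
      - (if v = c then (size par y : ℤ) else 0) := by
  symm
  refine (isRooted_reroot h).eq_size_of_recursion (f := fun v => (size par v : ℤ)
      + (if v = y then (Fintype.card V : ℤ) - size par y else 0)
      - (if v = c then (size par y : ℤ) else 0)) (fun v => ?_) v
  rw [sum_children_reroot h hyc hy, Finset.sum_sub_distrib, Finset.sum_add_distrib,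
    Finset.sum_ite_eq', Finset.sum_ite_eq', h.size_eq v]
  have h1 : c ∉ children par c v := by simp [IsRooted.mem_children]
  have h2 : y ∈ children par c v ↔ v = c := by
    rw [IsRooted.mem_children, hy, eq_comm (a := c)]
    exact and_iff_right hyc
  simp only [h1, h2, if_true, if_false, if_neg hyc, if_neg (Ne.symm hyc), h.size_root]
  push_cast
  by_cases hvc : v = c
  · subst hvc
    simp only [if_true, if_neg (Ne.symm hyc)]
    ring
  · by_cases hvy : v = y
    · simp only [hvy, if_true, if_neg hyc]
      ring
    · simp only [if_neg hvy, if_neg hvc]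
      ring

end reroot

/-- Every tree can be rooted so that no branch has more than half of the vertices. -/
theorem exists_balanced {V : Type*} [Fintype V] {T : SimpleGraph V} (hT : T.IsTree) :
    ∃ (par : V → V) (c : V), IsRooted par c ∧ parentGraph par = T ∧
      ∀ v, v ≠ c → 2 * size par v ≤ Fintype.card V := by
  obtain ⟨c₀⟩ := hT.connected.nonempty
  obtain ⟨par₀, h₀, hT₀⟩ := exists_parentGraph_eq hT c₀
  -- A rooting that minimises the total size is balanced: passing to a child y changes the total by
  -- n − 2 · size y, which is negative if the branch at y is too large.
  obtain ⟨⟨par, c⟩, ⟨h, hpT⟩, hmin⟩ := Set.exists_min_image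
    {q : (V → V) × V | IsRooted q.1 q.2 ∧ parentGraph q.1 = T} (fun q => ∑ v, size q.1 v)
    (Set.toFinite _) ⟨(par₀, c₀), h₀, hT₀⟩
  refine ⟨par, c, h, hpT, fun v hv => ?_⟩
  by_contra! hlt
  obtain ⟨y, hyc, hy, hyv⟩ := h.exists_child_anc (h.anc_root v) (Ne.symm hv)
  have h1 : size par v ≤ size par y := IsRooted.size_le_of_anc hyv
  have h2 := hmin (reroot par c y, y) ⟨isRooted_reroot h, (parentGraph_reroot h hyc hy).trans hpT⟩
  have h3 : (∑ v, (size (reroot par c y) v : ℤ))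
      = ∑ v, (size par v : ℤ) + (Fintype.card V - size par y) - size par y := by
    rw [Finset.sum_congr rfl fun v _ => size_reroot h hyc hy v, Finset.sum_sub_distrib,
      Finset.sum_add_distrib]
    simp
  have h4 : (∑ v, (size par v : ℤ)) ≤ ∑ v, (size (reroot par c y) v : ℤ) := by
    exact_mod_cast h2
  omega

/-! ### Invariance under isomorphism. -/

section iso

variable {V W : Type*} {par : V → V} {c : V}

theorem iterate_conj (e : V ≃ W) (k : ℕ) (x : V) :
    (e ∘ par ∘ e.symm)^[k] (e x) = e (par^[k] x) := by
  have : Function.Semiconj e par (e ∘ par ∘ e.symm) := fun v => by simp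
  exact ((this.iterate_right k) x).symm

theorem IsRooted.conj (h : IsRooted par c) (e : V ≃ W) : IsRooted (e ∘ par ∘ e.symm) (e c) := by
  refine ⟨by simp [h.root], fun w => ?_⟩
  obtain ⟨v, rfl⟩ := e.surjective w
  obtain ⟨k, hk⟩ := h.reach v
  exact ⟨k, by rw [iterate_conj, hk]⟩

theorem size_conj [Fintype V] [Fintype W] (e : V ≃ W) (v : V) :
    size (e ∘ par ∘ e.symm) (e v) = size par v := by
  symm
  refine Finset.card_equiv e fun x => ?_
  have hanc : Anc (e ∘ par ∘ e.symm) (e v) (e x) ↔ Anc par v x := by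
    simp only [Anc, iterate_conj, e.injective.eq_iff]
  simp [hanc]

theorem parentGraph_conj {G : SimpleGraph W} (e : parentGraph par ≃g G) :
    parentGraph (e ∘ par ∘ e.symm) = G := by
  ext u v
  obtain ⟨u, rfl⟩ := e.surjective u
  obtain ⟨v, rfl⟩ := e.surjective v
  rw [e.map_adj_iff, parentGraph_adj, parentGraph_adj]
  simp [e.injective.eq_iff]

theorem steinerWiener_add_wiener_eq_of_iso [Fintype V] [Fintype W] {T : SimpleGraph V}
    {G : SimpleGraph W} (hT : T.IsTree) (e : T ≃g G) {r : ℕ} (hr : 1 ≤ r) (ε : ℝ) :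
    (steinerWiener r T : ℝ) + ε * wiener T = steinerWiener r G + ε * wiener G := by
  obtain ⟨c⟩ := hT.connected.nonempty
  obtain ⟨par, h, rfl⟩ := exists_parentGraph_eq hT c
  have h' := h.conj e.toEquiv
  have hG : parentGraph (e.toEquiv ∘ par ∘ e.toEquiv.symm) = G := parentGraph_conj e
  rw [← edgeSum_edgeWeight h hr, ← hG, ← edgeSum_edgeWeight h' hr,
    ← Fintype.card_congr e.toEquiv, edgeSum, edgeSum]
  refine Finset.sum_equiv e.toEquiv (by simp) fun v _ => ?_
  rw [size_conj]

theorem HasDegreeSequence.of_iso [Fintype V] [Fintype W] {T : SimpleGraph V}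
    {G : SimpleGraph W} (e : T ≃g G) {D : Multiset ℕ} (hT : HasDegreeSequence T D) :
    HasDegreeSequence G D := by
  rw [HasDegreeSequence] at hT ⊢
  rw [← hT, ← Finset.map_univ_equiv e.toEquiv, Finset.map_val, Multiset.map_map]
  refine Multiset.map_congr rfl fun v _ => ?_
  exact e.degree_eq v

end iso

/-! ### Minimisers and the main theorem. -/

/-- A tree minimising `SW_r + ε W` among the trees with the same degrees is the greedy tree. -/
theorem nonempty_iso_greedyTree_of_minimal {V : Type*} [Fintype V] {D : Multiset ℕ} {r : ℕ}
    (hr : 1 ≤ r) {ε : ℝ} (hε : 0 < ε) {M : SimpleGraph V} (hM : M.IsTree)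
    (hMD : HasDegreeSequence M D)
    (hmin : ∀ T : SimpleGraph V, T.IsTree → HasDegreeSequence T D →
      (steinerWiener r M : ℝ) + ε * wiener M ≤ steinerWiener r T + ε * wiener T) :
    Nonempty (M ≃g greedyTree D) := by
  obtain ⟨par, c, h, rfl, hbal⟩ := exists_balanced hM
  have hD := (hasDegreeSequence_parentGraph h).1 hMD
  have hopt : IsOptimal (edgeWeight (Fintype.card V) r ε) par c := by
    intro par' h' hdeg
    rw [edgeSum_edgeWeight h hr, edgeSum_edgeWeight h' hr]
    exact hmin _ (parentGraph_isTree h') ((hasDegreeSequence_parentGraph h').2 (hdeg.trans hD))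
  obtain ⟨e, hdeg, hpar, hlt⟩ :=
    exists_order h (strictConcaveSymm_edgeWeight (Fintype.card V) r hε) hbal hopt
  exact nonempty_iso_greedyTree h hD e hdeg hpar hlt

theorem exists_minimal_tree {V : Type*} [Fintype V] {D : Multiset ℕ} (r : ℕ) (ε : ℝ)
    {T : SimpleGraph V} (hT : T.IsTree) (hTD : HasDegreeSequence T D) :
    ∃ M : SimpleGraph V, M.IsTree ∧ HasDegreeSequence M D ∧
      ∀ T : SimpleGraph V, T.IsTree → HasDegreeSequence T D →
        (steinerWiener r M : ℝ) + ε * wiener M ≤ steinerWiener r T + ε * wiener T := by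
  obtain ⟨M, hM, hmin⟩ := Set.exists_min_image
    {T : SimpleGraph V | T.IsTree ∧ HasDegreeSequence T D}
    (fun T => (steinerWiener r T : ℝ) + ε * wiener T) (Set.toFinite _) ⟨T, hT, hTD⟩
  exact ⟨M, hM.1, hM.2, fun T h1 h2 => hmin T ⟨h1, h2⟩⟩

/-- The greedy tree shares the value of some minimiser on `V`, being isomorphic to it; a tree
attaining this value is itself a minimiser, hence isomorphic to the greedy tree. -/
theorem greedyTree_minimal {V : Type*} [Fintype V] {D : Multiset ℕ} {r : ℕ} (hr : 1 ≤ r) {ε : ℝ}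
    (hε : 0 < ε) {T : SimpleGraph V} (hT : T.IsTree) (hTD : HasDegreeSequence T D) :
    (steinerWiener r (greedyTree D) : ℝ) + ε * wiener (greedyTree D)
        ≤ steinerWiener r T + ε * wiener T ∧
      ((steinerWiener r T : ℝ) + ε * wiener T
          = steinerWiener r (greedyTree D) + ε * wiener (greedyTree D)
        ↔ Nonempty (T ≃g greedyTree D)) := by
  obtain ⟨M, hM, hMD, hmin⟩ := exists_minimal_tree r ε hT hTD
  obtain ⟨e⟩ := nonempty_iso_greedyTree_of_minimal hr hε hM hMD hmin
  rw [← steinerWiener_add_wiener_eq_of_iso hM e hr ε]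
  refine ⟨hmin T hT hTD, fun heq => ?_, fun ⟨e'⟩ => ?_⟩
  · exact nonempty_iso_greedyTree_of_minimal hr hε hT hTD fun T' h1 h2 =>
      heq.le.trans (hmin T' h1 h2)
  · rw [steinerWiener_add_wiener_eq_of_iso hT e' hr ε,
      steinerWiener_add_wiener_eq_of_iso hM e hr ε]

end SteinerWiener

theorem mainTheorem6 (D : Multiset ℕ) (hD : SteinerWiener.IsTreeDegreeSequence D) :
    (SteinerWiener.greedyTree D).IsTree ∧
    SteinerWiener.HasDegreeSequence (SteinerWiener.greedyTree D) D ∧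
    ∀ r : ℕ, 1 ≤ r → ∀ (V : Type*) [Fintype V] (T : SimpleGraph V),
      T.IsTree → SteinerWiener.HasDegreeSequence T D →
        SteinerWiener.steinerWiener r (SteinerWiener.greedyTree D)
            ≤ SteinerWiener.steinerWiener r T ∧
        ∀ ε : ℝ, 0 < ε →
          (SteinerWiener.steinerWiener r (SteinerWiener.greedyTree D) : ℝ)
              + ε * SteinerWiener.wiener (SteinerWiener.greedyTree D)
            ≤ (SteinerWiener.steinerWiener r T : ℝ) + ε * SteinerWiener.wiener T ∧
          ((SteinerWiener.steinerWiener r T : ℝ) + ε * SteinerWiener.wiener T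
              = (SteinerWiener.steinerWiener r (SteinerWiener.greedyTree D) : ℝ)
                + ε * SteinerWiener.wiener (SteinerWiener.greedyTree D)
            ↔ Nonempty (T ≃g SteinerWiener.greedyTree D)) := by
  obtain ⟨T₀, hT₀, hTD₀⟩ := hD
  -- Any admissible parameters serve here: the greedy tree inherits treeness and degrees from an
  -- isomorphic minimiser.
  obtain ⟨M, hM, hMD, hmin⟩ := SteinerWiener.exists_minimal_tree 1 1 hT₀ hTD₀
  obtain ⟨e⟩ := SteinerWiener.nonempty_iso_greedyTree_of_minimal le_rfl one_pos hM hMD hmin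
  refine ⟨e.isTree_iff.1 hM, hMD.of_iso e, fun r hr V _ T hT hTD => ⟨?_, fun ε hε =>
    SteinerWiener.greedyTree_minimal hr hε hT hTD⟩⟩
  by_contra! hlt
  have hlt' : (SteinerWiener.steinerWiener r T : ℝ) + 1
      ≤ SteinerWiener.steinerWiener r (SteinerWiener.greedyTree D) := by exact_mod_cast hlt
  have hpos : (0 : ℝ) < SteinerWiener.wiener T + 1 := by positivity
  -- With ε = 1/(W(T) + 1) the term εW(T) is below 1, too small to make up an integer gap in SW_r.
  have h1 := (SteinerWiener.greedyTree_minimal (D := D) hr (inv_pos.2 hpos) hT hTD).1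
  have h2 : ((SteinerWiener.wiener T : ℝ) + 1)⁻¹ * SteinerWiener.wiener T < 1 := by
    rw [inv_mul_lt_one₀ hpos]
    linarith
  have h3 : 0 ≤ ((SteinerWiener.wiener T : ℝ) + 1)⁻¹
      * SteinerWiener.wiener (SteinerWiener.greedyTree D) := by positivity
  linarith
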